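/- Let $\sigma_x,\sigma_y,\sigma_z$ be the Pauli matrices and, for $\phi,\theta\in\mathbb R$, let $R_\phi(\theta)=\exp\!\big(-i\tfrac{\theta}{2}(\cos\phi\,\sigma_x+\sin\phi\,\sigma_y)\big)$. Write $x=\cos(\theta/2)$, $y=\sin(\theta/2)$. A tuple $(A,B,C,D)$ of polynomials is achievable by a composite gate of length $L$ if the polynomials have degree at most $L$ and there are phases $\phi_1,\dots,\phi_L\in\mathbb R$ such that for all $\theta\in\mathbb R$ $$R_{\phi_L}(\theta)\cdots R_{\phi_1}(\theta)=\begin{cases}A(x)\mathbb 1+iB(x)\sigma_z+iC(y)\sigma_x+iD(y)\sigma_y,& L\text{ odd},\\ A(x)\mathbb 1+iB(x)\sigma_z+ixC(y)\sigma_x+ixD(y)\sigma_y,& L\text{ even}.\end{cases}$$ A partial tuple, in which a dot marks an empty slot, is achievable by a gate of length $L$ if its empty slots can be filled with polynomials so that the resulting tuple is achievable by a gate of length $L$. Let $L\ge 0$ and let $A,B,C,D$ be real polynomials of degree at most $L$ such that $A,B,C,D$ are odd if $L$ is odd, while $A,B$ are even and $C,D$ are odd if $L$ is even. In the following, "achievable"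 may be read either as "achievable by a gate of length exactly $L$" or as "achievable by a gate of some length of the same parity as $L$"; the two are equivalent for the partial tuples considered. (1) If $A(1)=1$, then each of $(A,\cdot,C,\cdot)$ and $(A,\cdot,\cdot,C)$ is achievable iff for all $\theta\in\mathbb R$: $A(x)^2+C(y)^2\le 1$ if $L$ is odd, and $A(x)^2+x^2C(y)^2\le 1$ if $L$ is even. (2) If $B(1)=0$, then each of $(\cdot,B,C,\cdot)$ and $(\cdot,B,\cdot,C)$ is achievable iff for all $\theta\in\mathbb R$: $B(x)^2+C(y)^2\le 1$ if $L$ is odd, and $B(x)^2+x^2C(y)^2\le 1$ if $L$ is even. (3) If $A(1)=1$, then $(A,B,\cdot,\cdot)$ is achievable iff (a) $A(x)^2+B(x)^2\le 1$ for all $\theta\in\mathbb R$; (b) $A(x)^2+B(x)^2\ge 1$ for all real $x\ge 1$; and (c) if $L$ is even, $A(ix)^2+B(ix)^2\ge 1$ for all real $x\ge 0$. (4) $(\cdot,\cdot,C,D)$ is achievable iff (a) for all $\theta\in\mathbb R$: $C(y)^2+D(y)^2\le 1$ if $L$ is odd, and $x^2C(y)^2+x^2D(y)^2\le 1$ if $L$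 is even; and (b) if $L$ is odd, $C(y)^2+D(y)^2\ge 1$ for all real $y\ge 1$. -/

import Mathlib

open Polynomial
open scoped ComplexOrder

namespace CompositeGate

noncomputable section

/-- The Pauli matrix `σ_x`. -/
def pauliX : Matrix (Fin 2) (Fin 2) ℂ := !![0, 1; 1, 0]

/-- The Pauli matrix `σ_y`. -/
def pauliY : Matrix (Fin 2) (Fin 2) ℂ := !![0, -Complex.I; Complex.I, 0]

/-- The Pauli matrix `σ_z`. -/
def pauliZ : Matrix (Fin 2) (Fin 2) ℂ := !![1, 0; 0, -1]

/-- `σ_φ = cos φ σ_x + sin φ σ_y`. -/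
def pauliPhase (φ : ℝ) : Matrix (Fin 2) (Fin 2) ℂ :=
  (Real.cos φ : ℂ) • pauliX + (Real.sin φ : ℂ) • pauliY

/-- The primitive rotation `R_φ(θ) = exp(-i (θ/2) σ_φ)`. -/
def rotation (φ θ : ℝ) : Matrix (Fin 2) (Fin 2) ℂ :=
  NormedSpace.exp ((-Complex.I * ((θ / 2 : ℝ) : ℂ)) • pauliPhase φ)

/-- The response function `U(θ) = R_{φ_L}(θ) ⋯ R_{φ_2}(θ) R_{φ_1}(θ)` of the composite gate of
length `L` with phases `φ_1, …, φ_L` (here `φ_k` is `φ ⟨k - 1, _⟩`). -/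
def response {L : ℕ} (φ : Fin L → ℝ) (θ : ℝ) : Matrix (Fin 2) (Fin 2) ℂ :=
  (List.ofFn fun k => rotation (φ k) θ).reverse.prod

/-- With `x = cos (θ/2)` and `y = sin (θ/2)`, the matrix
`A(x) 1 + i B(x) σ_z + i C(y) σ_x + i D(y) σ_y` if `L` is odd and
`A(x) 1 + i B(x) σ_z + i x C(y) σ_x + i x D(y) σ_y` if `L` is even. -/
def polyForm (L : ℕ) (A B C D : ℂ[X]) (θ : ℝ) : Matrix (Fin 2) (Fin 2) ℂ :=
  let x : ℂ := (Real.cos (θ / 2) : ℂ)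
  let y : ℂ := (Real.sin (θ / 2) : ℂ)
  if Odd L then
    A.eval x • (1 : Matrix (Fin 2) (Fin 2) ℂ) + (Complex.I * B.eval x) • pauliZ
      + (Complex.I * C.eval y) • pauliX + (Complex.I * D.eval y) • pauliY
  else
    A.eval x • (1 : Matrix (Fin 2) (Fin 2) ℂ) + (Complex.I * B.eval x) • pauliZ
      + (Complex.I * (x * C.eval y)) • pauliX + (Complex.I * (x * D.eval y)) • pauliY

/-- `(A, B, C, D)` is a tuple of polynomials of degree at most `L` which is realized by some
composite gate of length `L`. -/
def AchievableBy (L : ℕ) (A B C D : ℂ[X]) : Prop :=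
  A.natDegree ≤ L ∧ B.natDegree ≤ L ∧ C.natDegree ≤ L ∧ D.natDegree ≤ L ∧
    ∃ φ : Fin L → ℝ, ∀ θ : ℝ, response φ θ = polyForm L A B C D θ

/-- A slot of a partial tuple (`none` is an empty slot) is consistent with the polynomial `P`. -/
def SlotConsistent (s : Option ℝ[X]) (P : ℂ[X]) : Prop :=
  ∀ p ∈ s, P = p.map Complex.ofRealHom

/-- A partial tuple of real polynomials is consistent with some tuple of (a priori complex)
polynomials that is realized by a composite gate of length `L`. -/
def PartialAchievableBy (L : ℕ) (a b c d : Option ℝ[X]) : Prop :=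
  ∃ A B C D : ℂ[X], SlotConsistent a A ∧ SlotConsistent b B ∧ SlotConsistent c C ∧
    SlotConsistent d D ∧ AchievableBy L A B C D

/-- A partial tuple is consistent with some tuple realized by a composite gate whose length,
otherwise arbitrary, has the parity of `L`. -/
def PartialAchievableParity (L : ℕ) (a b c d : Option ℝ[X]) : Prop :=
  ∃ n : ℕ, (Odd n ↔ Odd L) ∧ PartialAchievableBy n a b c d

/-- `p(-X) = p(X)`. -/
def IsEvenPoly (p : ℝ[X]) : Prop := p.comp (-X) = p

/-- `p(-X) = -p(X)`. -/
def IsOddPoly (p : ℝ[X]) : Prop := p.comp (-X) = -p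

end

end CompositeGate

/-!
In the variable `s = x² = 1 - y²` the parity conditions say that a tuple is the same thing as four
real polynomials `a, b, c, d` in `s`: for odd length the components of the response function are
`x a(s)`, `x b(s)`, `y c(s)`, `y d(s)`, and for even length they are `a(s)`, `b(s)`, `x y c(s)`,
`x y d(s)`. Unitarity becomes a polynomial identity, `s (a² + b²) + (1 - s) (c² + d²) = 1` for odd
length (`OddUnitary`) and `a² + b² + s (1 - s) (c² + d²) = 1` for even length (`EvenUnitary`).

Every gate gives such a unitary quadruple (`exists_form_of_response`). Conversely, a unitary
quadruple within the degree bounds and with `a(1) = 1` comes from a gate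
(`EvenUnitary.exists_response`, `OddUnitary.exists_response`): comparing top coefficients in the
unitarity identity, the leading coefficients of `(a, b)` and `(c, d)` have equal length, so one
rotation can be chosen whose inverse cancels them all and lowers the length by one.

It remains to see when two of the four polynomials can be completed to a unitary quadruple. Given
one of `a, b` and one of `c, d`, the missing ones have to satisfy `p = s b² + (1 - s) d²`, or
`p = b² + s (1 - s) d²`, where `p` is the defect in the identity. By the Markov–Lukács theorem
(`unitIntervalForm_of_nonneg`) this is possible exactly when `p` is nonnegative on `[0, 1]`. Given
`a, b` or `c, d`, the defect is divisible by the weight of the missing pair, and the quotient has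
to be a sum of two squares, which means that it is nonnegative on the whole real line
(`exists_sq_add_sq_of_nonneg`). The conditions on `[0, 1]`, on `x ≥ 1` and on the imaginary axis
are the cases `0 ≤ s ≤ 1`, `s ≥ 1` and `s ≤ 0` of this. Both representation theorems are proved by
splitting off real zeros and pairs of conjugate zeros. The normalization `a(1) = 1` is either given
or obtained by a rotation of the pair `(a, b)` or a change of sign.
-/

namespace CompositeGate

/-! ### Degree bounds and nonnegative quotients -/

theorem natDegree_le_of_mem_degreeLT {n : ℕ} {p : ℝ[X]} (hp : p ∈ degreeLT ℝ (n + 1)) :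
    p.natDegree ≤ n := by
  rw [mem_degreeLT, degree_lt_iff_coeff_zero] at hp
  exact natDegree_le_iff_coeff_eq_zero.mpr fun j hj => hp j hj

theorem eq_zero_of_mem_degreeLT_zero {p : ℝ[X]} (hp : p ∈ degreeLT ℝ 0) : p = 0 := by
  have : p.degree < 0 := by simpa [mem_degreeLT] using hp
  simpa using this

theorem mul_mem_degreeLT {k n : ℕ} {w p : ℝ[X]} (hw : w.natDegree ≤ k)
    (hp : p ∈ degreeLT ℝ n) : w * p ∈ degreeLT ℝ (n + k) := by
  rw [mem_degreeLT, degree_lt_iff_coeff_zero] at *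
  intro j hj
  refine coeff_mul (R := ℝ) w p j ▸ Finset.sum_eq_zero fun ⟨a, b⟩ hab => ?_
  replace hab : a + b = j := by simpa using hab
  change w.coeff a * p.coeff b = 0
  by_cases ha : a ≤ k
  · rw [hp b (by omega), mul_zero]
  · rw [coeff_eq_zero_of_natDegree_lt (by omega), zero_mul]

theorem mem_degreeLT_of_mul {k n : ℕ} {w p : ℝ[X]} (hw : w.natDegree = k) (hw0 : w ≠ 0)
    (h : w * p ∈ degreeLT ℝ (n + k)) : p ∈ degreeLT ℝ n := by
  rcases eq_or_ne p 0 with rfl | hp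
  · exact Submodule.zero_mem _
  rw [mem_degreeLT] at *
  rw [degree_eq_natDegree (mul_ne_zero hw0 hp), natDegree_mul hw0 hp, hw] at h
  rw [degree_eq_natDegree hp]
  norm_cast at *
  omega

theorem C_mul_mem_degreeLT {n : ℕ} {p : ℝ[X]} (r : ℝ) (hp : p ∈ degreeLT ℝ n) :
    C r * p ∈ degreeLT ℝ n := by
  rw [← smul_eq_C_mul]
  exact Submodule.smul_mem _ r hp

theorem X_mul_mem_degreeLT {n : ℕ} {p : ℝ[X]} (hp : p ∈ degreeLT ℝ n) :
    X * p ∈ degreeLT ℝ (n + 1) :=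
  mul_mem_degreeLT natDegree_X_le hp

theorem one_sub_X_mul_mem_degreeLT {n : ℕ} {p : ℝ[X]} (hp : p ∈ degreeLT ℝ n) :
    (1 - X) * p ∈ degreeLT ℝ (n + 1) :=
  mul_mem_degreeLT (by compute_degree) hp

theorem C_mem_degreeLT_succ (r : ℝ) (n : ℕ) : C r ∈ degreeLT ℝ (n + 1) := by
  rw [mem_degreeLT]
  refine degree_C_le.trans_lt ?_
  exact_mod_cast Nat.succ_pos n

/-- The sign of a quotient on an interval can be read off from dividend times divisor, the zeros
of the divisor being covered by continuity. -/
theorem eval_nonneg_of_mul {w q : ℝ[X]} (hw : w ≠ 0) {u v : ℝ} (huv : u < v)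
    (h : ∀ s ∈ Set.Icc u v, 0 ≤ w.eval s * (w * q).eval s) :
    ∀ s ∈ Set.Icc u v, 0 ≤ q.eval s := by
  have hdense : Dense ((w.roots.toFinset : Set ℝ)ᶜ) := Set.Countable.dense_compl ℝ
    (Finset.countable_toSet _)
  have hcl : Set.Icc u v ⊆ {s | 0 ≤ q.eval s} := by
    rw [← closure_Ioo huv.ne]
    refine (closure_mono (hdense.open_subset_closure_inter isOpen_Ioo)).trans ?_
    rw [closure_closure]
    refine closure_minimal ?_ (isClosed_le continuous_const q.continuous)
    rintro s ⟨hs, hws⟩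
    have hne : w.eval s ≠ 0 := by
      simpa [hw] using hws
    have := h s (Set.Ioo_subset_Icc_self hs)
    rw [eval_mul, ← mul_assoc] at this
    exact nonneg_of_mul_nonneg_right this (mul_self_pos.mpr hne)
  exact hcl

theorem eval_nonneg_of_mul_univ {w q : ℝ[X]} (hw : w ≠ 0)
    (h : ∀ s, 0 ≤ w.eval s * (w * q).eval s) (s : ℝ) : 0 ≤ q.eval s :=
  eval_nonneg_of_mul hw (show s - 1 < s + 1 by linarith) (fun t _ => h t) s
    ⟨by linarith, by linarith⟩

/-- An interior zero of a polynomial that is nonnegative on an interval has multiplicity at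
least two. -/
theorem exists_eq_sq_mul_of_nonneg {p : ℝ[X]} {u r v : ℝ} (hur : u < r) (hrv : r < v)
    (hroot : p.IsRoot r) (h : ∀ s ∈ Set.Icc u v, 0 ≤ p.eval s) :
    ∃ q, p = (X - C r) ^ 2 * q := by
  obtain ⟨q, rfl⟩ := dvd_iff_isRoot.mpr hroot
  have hne : (X - C r : ℝ[X]) ≠ 0 := X_sub_C_ne_zero r
  have h1 : 0 ≤ q.eval r := by
    refine eval_nonneg_of_mul hne hrv (fun s hs => ?_) r ⟨le_rfl, hrv.le⟩
    refine mul_nonneg ?_ (h s ⟨hur.le.trans hs.1, hs.2⟩)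
    simpa using hs.1
  have h2 : 0 ≤ (-q).eval r := by
    refine eval_nonneg_of_mul hne hur (fun s hs => ?_) r ⟨hur.le, le_rfl⟩
    rw [mul_neg, eval_neg, mul_neg, neg_nonneg]
    refine mul_nonpos_of_nonpos_of_nonneg ?_ (h s ⟨hs.1, hs.2.trans hrv.le⟩)
    simpa using hs.2
  rw [eval_neg] at h2
  obtain ⟨q', rfl⟩ := dvd_iff_isRoot.mpr (show q.IsRoot r from le_antisymm (by linarith) h1)
  exact ⟨q', by ring⟩

/-- The real quadratic `(X - z) (X - z̄)`. -/
noncomputable def conjQuadratic (z : ℂ) : ℝ[X] := X ^ 2 - C (2 * z.re) * X + C (‖z‖ ^ 2)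

theorem conjQuadratic_eq (z : ℂ) : conjQuadratic z = (X - C z.re) ^ 2 + C z.im ^ 2 := by
  rw [conjQuadratic, ← Complex.normSq_eq_norm_sq, Complex.normSq_apply]
  simp only [map_add, map_mul, map_ofNat]
  ring

theorem natDegree_conjQuadratic (z : ℂ) : (conjQuadratic z).natDegree = 2 := by
  rw [conjQuadratic]
  compute_degree!

theorem conjQuadratic_ne_zero (z : ℂ) : conjQuadratic z ≠ 0 :=
  ne_zero_of_natDegree_gt (n := 0) (by rw [natDegree_conjQuadratic]; norm_num)

theorem exists_root_or_conjQuadratic_dvd {p : ℝ[X]} (hp : 0 < p.degree) :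
    (∃ r, p.IsRoot r) ∨ ∃ z : ℂ, conjQuadratic z ∣ p := by
  obtain ⟨z, hz⟩ := Complex.exists_root (f := p.map (algebraMap ℝ ℂ)) (by rwa [degree_map])
  rw [IsRoot, eval_map_algebraMap] at hz
  by_cases him : z.im = 0
  · left
    refine ⟨z.re, ?_⟩
    obtain ⟨r, rfl⟩ : ∃ r : ℝ, z = r := ⟨z.re, Complex.ext rfl (by simpa using him)⟩
    have := aeval_algebraMap_apply (A := ℝ) ℂ r p
    rw [Complex.coe_algebraMap, hz] at this
    exact_mod_cast this.symm
  · exact Or.inr ⟨z, quadratic_dvd_of_aeval_eq_zero_im_ne_zero p hz him⟩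

/-! ### Sums of two squares -/

/-- A real polynomial that is nonnegative on the real line is a sum of two squares: split off
a double real zero or a pair of conjugate zeros and use the two-squares identity. -/
theorem exists_sq_add_sq_of_nonneg (m : ℕ) (q : ℝ[X]) (hq : q ∈ degreeLT ℝ (2 * m))
    (hnn : ∀ s, 0 ≤ q.eval s) :
    ∃ c ∈ degreeLT ℝ m, ∃ d ∈ degreeLT ℝ m, q = c ^ 2 + d ^ 2 := by
  induction m generalizing q with
  | zero =>
    refine ⟨0, Submodule.zero_mem _, 0, Submodule.zero_mem _, ?_⟩
    simp [eq_zero_of_mem_degreeLT_zero hq]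
  | succ m ih =>
    rcases le_or_gt q.degree 0 with h0 | hpos
    · rw [eq_C_of_degree_le_zero h0] at hnn ⊢
      refine ⟨C √(q.coeff 0), C_mem_degreeLT_succ _ _, 0, Submodule.zero_mem _, ?_⟩
      have := hnn 0
      rw [eval_C] at this
      rw [← C_pow, Real.sq_sqrt this]
      ring
    obtain ⟨e, f, q', he, hf, rfl⟩ : ∃ (e : ℝ) (f : ℝ) (q' : ℝ[X]),
        ((X - C e) ^ 2 + C f ^ 2 : ℝ[X]).natDegree = 2 ∧ ((X - C e) ^ 2 + C f ^ 2 : ℝ[X]) ≠ 0 ∧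
        q = ((X - C e) ^ 2 + C f ^ 2) * q' := by
      rcases exists_root_or_conjQuadratic_dvd hpos with ⟨r, hr⟩ | ⟨z, q', rfl⟩
      · obtain ⟨q', rfl⟩ := exists_eq_sq_mul_of_nonneg (sub_one_lt r) (lt_add_one r) hr
          (fun s _ => hnn s)
        refine ⟨r, 0, q', ?_, ?_, by simp⟩
        · simp
        · simpa using X_sub_C_ne_zero r
      · refine ⟨z.re, z.im, q', ?_, ?_, by rw [conjQuadratic_eq]⟩ <;> rw [← conjQuadratic_eq]
        · exact natDegree_conjQuadratic z
        · exact conjQuadratic_ne_zero z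
    obtain ⟨c, hc, d, hd, rfl⟩ := ih q' (mem_degreeLT_of_mul he hf hq)
      (eval_nonneg_of_mul_univ hf fun s => mul_nonneg (by simp; positivity) (hnn s))
    have hX : ∀ {p : ℝ[X]}, p ∈ degreeLT ℝ m → (X - C e) * p ∈ degreeLT ℝ (m + 1) :=
      fun hp => mul_mem_degreeLT (natDegree_X_sub_C_le e) hp
    have hC : ∀ {p : ℝ[X]}, p ∈ degreeLT ℝ m → C f * p ∈ degreeLT ℝ (m + 1) :=
      fun hp => mul_mem_degreeLT (by simp) hp
    exact ⟨(X - C e) * c - C f * d, Submodule.sub_mem _ (hX hc) (hC hd),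
      (X - C e) * d + C f * c, Submodule.add_mem _ (hX hd) (hC hc), by ring⟩

/-- A rotation of the two squares makes the first one carry the whole value at `1`. -/
theorem exists_sq_add_sq_eval_one {m : ℕ} {q : ℝ[X]} (hq : q ∈ degreeLT ℝ (2 * m))
    (hnn : ∀ s, 0 ≤ q.eval s) (h1 : q.eval 1 = 1) :
    ∃ a ∈ degreeLT ℝ m, ∃ b ∈ degreeLT ℝ m, q = a ^ 2 + b ^ 2 ∧ a.eval 1 = 1 := by
  obtain ⟨c, hc, d, hd, rfl⟩ := exists_sq_add_sq_of_nonneg m q hq hnn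
  simp only [eval_add, eval_pow] at h1
  refine ⟨C (c.eval 1) * c + C (d.eval 1) * d,
    Submodule.add_mem _ (C_mul_mem_degreeLT _ hc) (C_mul_mem_degreeLT _ hd),
    C (c.eval 1) * d - C (d.eval 1) * c,
    Submodule.sub_mem _ (C_mul_mem_degreeLT _ hd) (C_mul_mem_degreeLT _ hc), ?_, ?_⟩
  · have : (C (c.eval 1) ^ 2 + C (d.eval 1) ^ 2 : ℝ[X]) = 1 := by
      rw [← C_pow, ← C_pow, ← C_add, h1, C_1]
    linear_combination (-(c ^ 2 + d ^ 2)) * this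
  · simp only [eval_add, eval_mul, eval_C]
    linarith

/-! ### Nonnegativity on the unit interval -/

/-- A Markov–Lukács certificate of nonnegativity on `[0, 1]` for polynomials of degree less
than `n`: `X b² + (1 - X) d²` if `n` is even and `b² + X (1 - X) d²` if `n` is odd. -/
def UnitIntervalForm (n : ℕ) (p : ℝ[X]) : Prop :=
  ∃ m : ℕ, ∃ b d : ℝ[X],
    (n = 2 * m ∧ b ∈ degreeLT ℝ m ∧ d ∈ degreeLT ℝ m ∧ p = X * b ^ 2 + (1 - X) * d ^ 2) ∨
    (n = 2 * m + 1 ∧ b ∈ degreeLT ℝ (m + 1) ∧ d ∈ degreeLT ℝ m ∧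
      p = b ^ 2 + X * (1 - X) * d ^ 2)

/-- Multiplicativity follows from the two-squares identity applied to `√s b + i √(1 - s) d` and its
analogues. -/
theorem UnitIntervalForm.linear_mul {n : ℕ} {p : ℝ[X]} (h : UnitIntervalForm n p) {u v : ℝ}
    (hu : 0 ≤ u) (hv : 0 ≤ v) : UnitIntervalForm (n + 1) ((C u * X + C v * (1 - X)) * p) := by
  have hu' : (C u : ℝ[X]) = C √u ^ 2 := by rw [← C_pow, Real.sq_sqrt hu]
  have hv' : (C v : ℝ[X]) = C √v ^ 2 := by rw [← C_pow, Real.sq_sqrt hv]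
  rw [hu', hv']
  set e := √u
  set f := √v
  obtain ⟨m, b, d, ⟨rfl, hb, hd, rfl⟩ | ⟨rfl, hb, hd, rfl⟩⟩ := h
  · refine ⟨m, C e * (X * b) + C f * ((1 - X) * d), C e * d - C f * b,
      Or.inr ⟨rfl, ?_, ?_, by ring⟩⟩
    · exact Submodule.add_mem _ (C_mul_mem_degreeLT _ (X_mul_mem_degreeLT hb))
        (C_mul_mem_degreeLT _ (one_sub_X_mul_mem_degreeLT hd))
    · exact Submodule.sub_mem _ (C_mul_mem_degreeLT _ hd) (C_mul_mem_degreeLT _ hb)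
  · refine ⟨m + 1, C e * b + C f * ((1 - X) * d), C f * b - C e * (X * d),
      Or.inl ⟨by ring, ?_, ?_, by ring⟩⟩
    · exact Submodule.add_mem _ (C_mul_mem_degreeLT _ hb)
        (C_mul_mem_degreeLT _ (one_sub_X_mul_mem_degreeLT hd))
    · exact Submodule.sub_mem _ (C_mul_mem_degreeLT _ hb)
        (C_mul_mem_degreeLT _ (X_mul_mem_degreeLT hd))

theorem UnitIntervalForm.quadratic_mul {n : ℕ} {p : ℝ[X]} (h : UnitIntervalForm n p)
    {l : ℝ[X]} {k : ℝ} (hl : l.natDegree ≤ 1) :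
    UnitIntervalForm (n + 2) ((l ^ 2 + X * (1 - X) * C k ^ 2) * p) := by
  obtain ⟨m, b, d, ⟨rfl, hb, hd, rfl⟩ | ⟨rfl, hb, hd, rfl⟩⟩ := h
  · exact ⟨m + 1, l * b + C k * ((1 - X) * d), l * d - C k * (X * b), Or.inl ⟨by ring,
      Submodule.add_mem _ (mul_mem_degreeLT hl hb)
        (C_mul_mem_degreeLT _ (one_sub_X_mul_mem_degreeLT hd)),
      Submodule.sub_mem _ (mul_mem_degreeLT hl hd)
        (C_mul_mem_degreeLT _ (X_mul_mem_degreeLT hb)), by ring⟩⟩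
  · exact ⟨m + 1, l * b - C k * (X * ((1 - X) * d)), l * d + C k * b, Or.inr ⟨by ring,
      Submodule.sub_mem _ (mul_mem_degreeLT hl hb)
        (C_mul_mem_degreeLT _ (X_mul_mem_degreeLT (one_sub_X_mul_mem_degreeLT hd))),
      Submodule.add_mem _ (mul_mem_degreeLT hl hd) (C_mul_mem_degreeLT _ hb), by ring⟩⟩

/-- With `l = ‖1 - z‖ X - ‖z‖ (1 - X)` the difference `(X - z) (X - z̄) - l²` vanishes at `0` and
`1`; its remaining coefficient is nonnegative by the triangle inequality for `0`, `z`, `1`. -/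
theorem exists_conjQuadratic_eq (z : ℂ) :
    ∃ (l : ℝ[X]) (k : ℝ), l.natDegree ≤ 1 ∧ conjQuadratic z = l ^ 2 + X * (1 - X) * C k ^ 2 := by
  have htri : 1 ≤ ‖z‖ + ‖1 - z‖ := by
    simpa using norm_add_le z (1 - z)
  have hk : 0 ≤ (‖z‖ + ‖1 - z‖) ^ 2 - 1 := by nlinarith
  have hnorm : ‖1 - z‖ ^ 2 = 1 - 2 * z.re + ‖z‖ ^ 2 := by
    rw [← Complex.normSq_eq_norm_sq, ← Complex.normSq_eq_norm_sq, Complex.normSq_apply,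
      Complex.normSq_apply]
    simp
    ring
  refine ⟨C ‖1 - z‖ * X - C ‖z‖ * (1 - X), √((‖z‖ + ‖1 - z‖) ^ 2 - 1), ?_, ?_⟩
  · compute_degree
  · rw [← C_pow, Real.sq_sqrt hk, conjQuadratic]
    have := congrArg (C : ℝ → ℝ[X]) hnorm
    simp only [map_add, map_sub, map_mul, map_pow, map_one, map_ofNat] at this ⊢
    linear_combination (-X) * this

/-- The Markov–Lukács theorem on `[0, 1]`, by splitting off zeros. -/
theorem unitIntervalForm_of_nonneg (n : ℕ) (p : ℝ[X]) (hp : p ∈ degreeLT ℝ n)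
    (hnn : ∀ s ∈ Set.Icc (0 : ℝ) 1, 0 ≤ p.eval s) : UnitIntervalForm n p := by
  induction n using Nat.strong_induction_on generalizing p with
  | _ n ih =>
  rcases n with _ | n
  · refine ⟨0, 0, 0, Or.inl ⟨rfl, Submodule.zero_mem _, Submodule.zero_mem _, ?_⟩⟩
    simp [eq_zero_of_mem_degreeLT_zero hp]
  by_cases hlt : p ∈ degreeLT ℝ n
  · -- Below the top degree, pad with the factor `1 = X + (1 - X)`.
    simpa using (ih n (by omega) p hlt hnn).linear_mul zero_le_one zero_le_one
  rcases le_or_gt p.degree 0 with h0 | hpos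
  · have hn : n = 0 := by
      by_contra hn
      exact hlt (mem_degreeLT.mpr (h0.trans_lt (by exact_mod_cast Nat.pos_of_ne_zero hn)))
    subst hn
    rw [eq_C_of_degree_le_zero h0] at hnn ⊢
    refine ⟨0, C √(p.coeff 0), 0, Or.inr ⟨rfl, C_mem_degreeLT_succ _ _, Submodule.zero_mem _, ?_⟩⟩
    have := hnn 0 (by simp)
    rw [eval_C] at this
    rw [← C_pow, Real.sq_sqrt this]
    ring
  -- Either a linear factor that is nonnegative on `[0, 1]` or a quadratic one splits off.
  have linear : ∀ (u v : ℝ) (q : ℝ[X]), 0 ≤ u → 0 ≤ v → u ≠ v →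
      p = (C u * X + C v * (1 - X)) * q → UnitIntervalForm (n + 1) p := by
    rintro u v q hu hv huv rfl
    have hdeg : (C u * X + C v * (1 - X) : ℝ[X]).natDegree = 1 := by
      rw [show (C u * X + C v * (1 - X) : ℝ[X]) = C (u - v) * X + C v by rw [C_sub]; ring]
      exact natDegree_linear (sub_ne_zero.mpr huv)
    have hne : (C u * X + C v * (1 - X) : ℝ[X]) ≠ 0 :=
      ne_zero_of_natDegree_gt (n := 0) (by omega)
    refine (ih n (by omega) q (mem_degreeLT_of_mul hdeg hne hp) ?_).linear_mul hu hv
    refine eval_nonneg_of_mul hne zero_lt_one fun s hs => mul_nonneg ?_ (hnn s hs)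
    simp only [eval_add, eval_mul, eval_C, eval_X, eval_sub, eval_one]
    have := hs.1
    have := sub_nonneg.mpr hs.2
    positivity
  have quadratic : ∀ (w q l : ℝ[X]) (k : ℝ), w.natDegree = 2 → l.natDegree ≤ 1 →
      w = l ^ 2 + X * (1 - X) * C k ^ 2 → p = w * q → UnitIntervalForm (n + 1) p := by
    rintro w q l k hdeg hl hw rfl
    have hne : w ≠ 0 := ne_zero_of_natDegree_gt (n := 0) (by omega)
    obtain ⟨n, rfl⟩ : ∃ n', n = n' + 1 := by
      refine ⟨n - 1, ?_⟩
      rcases n with _ | n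
      · have hq : q ≠ 0 := by rintro rfl; simp at hpos
        rw [mem_degreeLT, degree_eq_natDegree (mul_ne_zero hne hq), natDegree_mul hne hq,
          hdeg] at hp
        norm_cast at hp
        omega
      · rfl
    have := ih n (by omega) q (mem_degreeLT_of_mul hdeg hne hp) <|
      eval_nonneg_of_mul hne zero_lt_one fun s hs => mul_nonneg (by
        rw [hw]
        simp only [eval_add, eval_mul, eval_pow, eval_C, eval_X, eval_sub, eval_one]
        have := hs.1
        have := sub_nonneg.mpr hs.2
        positivity) (hnn s hs)
    rw [hw]
    exact this.quadratic_mul hl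
  rcases exists_root_or_conjQuadratic_dvd hpos with ⟨r, hr⟩ | ⟨z, q, hq⟩
  · rcases le_or_gt r 0 with hr0 | hr0
    · obtain ⟨q, hq⟩ := dvd_iff_isRoot.mpr hr
      refine linear (1 - r) (-r) q (by linarith) (by linarith) (by simp) ?_
      rw [hq]
      simp only [map_sub, map_neg, map_one]
      ring
    · rcases le_or_gt 1 r with hr1 | hr1
      · obtain ⟨q, hq⟩ := dvd_iff_isRoot.mpr hr
        refine linear (r - 1) r (-q) (by linarith) (by linarith) (by simp) ?_
        rw [hq]
        simp only [map_sub, map_one]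
        ring
      · obtain ⟨q, hq⟩ := exists_eq_sq_mul_of_nonneg hr0 hr1 hr hnn
        exact quadratic _ q (X - C r) 0 (by simp) (natDegree_X_sub_C_le r)
          (by simp) hq
  · obtain ⟨l, k, hl, hlk⟩ := exists_conjQuadratic_eq z
    exact quadratic _ q l k (natDegree_conjQuadratic z) hl hlk hq

/-! ### Rotations as quaternions -/

/-- The matrix `α 1 + i β σ_z + i γ σ_x + i δ σ_y`. -/
noncomputable def quat (α β γ δ : ℂ) : Matrix (Fin 2) (Fin 2) ℂ :=
  α • 1 + (Complex.I * β) • pauliZ + (Complex.I * γ) • pauliX + (Complex.I * δ) • pauliY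

theorem quat_eq (α β γ δ : ℂ) : quat α β γ δ =
    !![α + Complex.I * β, Complex.I * γ + δ; Complex.I * γ - δ, α - Complex.I * β] := by
  ext i j
  fin_cases i <;> fin_cases j <;>
    simp [quat, pauliX, pauliY, pauliZ, sub_eq_add_neg] <;> ring_nf <;> simp

theorem quat_inj {α β γ δ α' β' γ' δ' : ℂ} (h : quat α β γ δ = quat α' β' γ' δ') :
    α = α' ∧ β = β' ∧ γ = γ' ∧ δ = δ' := by
  rw [quat_eq, quat_eq] at h
  have h00 := congrFun (congrFun h 0) 0
  have h01 := congrFun (congrFun h 0) 1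
  have h10 := congrFun (congrFun h 1) 0
  have h11 := congrFun (congrFun h 1) 1
  simp at h00 h01 h10 h11
  have hI : Complex.I ≠ 0 := Complex.I_ne_zero
  refine ⟨by linear_combination (h00 + h11) / 2, mul_left_cancel₀ hI ?_, mul_left_cancel₀ hI ?_,
    by linear_combination (h01 - h10) / 2⟩
  · linear_combination (h00 - h11) / 2
  · linear_combination (h01 + h10) / 2

theorem quat_mul (α β γ δ α' β' γ' δ' : ℂ) : quat α β γ δ * quat α' β' γ' δ' =
    quat (α * α' - β * β' - γ * γ' - δ * δ') (α * β' + β * α' - γ * δ' + δ * γ')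
      (α * γ' + γ * α' + β * δ' - δ * β') (α * δ' + δ * α' - β * γ' + γ * β') := by
  simp only [quat_eq]
  ext i j
  fin_cases i <;> fin_cases j <;>
    simp [Matrix.mul_apply, Fin.sum_univ_two] <;> ring_nf <;> simp <;> ring

theorem fin_two_congr {a b c d a' b' c' d' : ℂ} (ha : a = a') (hb : b = b') (hc : c = c')
    (hd : d = d') : !![a, b; c, d] = !![a', b'; c', d'] := by
  rw [ha, hb, hc, hd]

theorem rotation_eq (φ θ : ℝ) : rotation φ θ =
    quat (Real.cos (θ / 2)) 0 (-(Real.sin (θ / 2) * Real.cos φ))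
      (-(Real.sin (θ / 2) * Real.sin φ)) := by
  have hI := Complex.I_mul_I
  have hcs : ((Real.cos φ : ℝ) : ℂ) ^ 2 + ((Real.sin φ : ℝ) : ℂ) ^ 2 = 1 := by
    exact_mod_cast Real.cos_sq_add_sin_sq φ
  unfold rotation pauliPhase
  generalize ((Real.cos φ : ℝ) : ℂ) = c at *
  generalize ((Real.sin φ : ℝ) : ℂ) = s at *
  -- The columns of `V` are the eigenvectors of `σ_φ`, with eigenvalues `1` and `-1`.
  let V : (Matrix (Fin 2) (Fin 2) ℂ)ˣ :=
    { val := !![1, 1; c + Complex.I * s, -(c + Complex.I * s)]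
      inv := !![1 / 2, (c - Complex.I * s) / 2; 1 / 2, -((c - Complex.I * s) / 2)]
      val_inv := by
        rw [Matrix.mul_fin_two, Matrix.one_fin_two]
        refine fin_two_congr ?_ ?_ ?_ ?_
        · norm_num
        · ring
        · ring
        · linear_combination hcs - s ^ 2 * hI
      inv_val := by
        rw [Matrix.mul_fin_two, Matrix.one_fin_two]
        refine fin_two_congr ?_ ?_ ?_ ?_
        · linear_combination (hcs - s ^ 2 * hI) / 2
        · linear_combination -(hcs - s ^ 2 * hI) / 2
        · linear_combination -(hcs - s ^ 2 * hI) / 2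
        · linear_combination (hcs - s ^ 2 * hI) / 2 }
  have hdiag (u v : ℂ) : V.val * Matrix.diagonal ![u, v] * V⁻¹.val =
      !![(u + v) / 2, (u - v) / 2 * (c - Complex.I * s);
        (u - v) / 2 * (c + Complex.I * s), (u + v) / 2] := by
    have h : Matrix.diagonal ![u, v] = !![u, 0; 0, v] := by
      ext i j
      fin_cases i <;> fin_cases j <;> rfl
    change !![1, 1; c + Complex.I * s, -(c + Complex.I * s)] * _ *
      !![1 / 2, (c - Complex.I * s) / 2; 1 / 2, -((c - Complex.I * s) / 2)] = _
    rw [h, Matrix.mul_fin_two, Matrix.mul_fin_two]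
    refine fin_two_congr ?_ ?_ ?_ ?_
    · ring
    · ring
    · ring
    · linear_combination (u + v) / 2 * (hcs - s ^ 2 * hI)
  set t : ℂ := ((θ / 2 : ℝ) : ℂ) with ht
  have hconj : (-Complex.I * t) • (c • pauliX + s • pauliY) =
      V.val * Matrix.diagonal ![-t * Complex.I, t * Complex.I] * V⁻¹.val := by
    rw [hdiag]
    ext i j
    fin_cases i <;> fin_cases j <;> simp [pauliX, pauliY] <;> ring
  have hexp : NormedSpace.exp ![-t * Complex.I, t * Complex.I] =
      ![Complex.exp (-t * Complex.I), Complex.exp (t * Complex.I)] := by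
    ext i
    rw [Pi.coe_exp, ← Complex.exp_eq_exp_ℂ]
    fin_cases i <;> rfl
  rw [hconj, Matrix.exp_units_conj, Matrix.exp_diagonal, hexp, hdiag, quat_eq, Complex.ofReal_cos,
    Complex.ofReal_sin, Complex.exp_mul_I, Complex.exp_mul_I, Complex.cos_neg, Complex.sin_neg,
    ← ht]
  refine fin_two_congr ?_ ?_ ?_ ?_
  · ring
  · linear_combination Complex.sin t * s * hI
  · linear_combination -(Complex.sin t * s) * hI
  · ring

theorem response_snoc {L : ℕ} (φ : Fin L → ℝ) (ψ θ : ℝ) :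
    response (Fin.snoc φ ψ : Fin (L + 1) → ℝ) θ = rotation ψ θ * response φ θ := by
  rw [response, response, List.ofFn_succ']
  simp

/-! ### Entries of the response function -/

/-- The response function of a gate of odd length: the four components are `x a(x²)`, `x b(x²)`,
`y c(x²)` and `y d(x²)`, where `x = cos (θ/2)` and `y = sin (θ/2)`. -/
noncomputable def oddForm (a b c d : ℝ[X]) (θ : ℝ) : Matrix (Fin 2) (Fin 2) ℂ :=
  let x := Real.cos (θ / 2)
  let y := Real.sin (θ / 2)
  quat (x * a.eval (x ^ 2) : ℝ) (x * b.eval (x ^ 2) : ℝ) (y * c.eval (x ^ 2) : ℝ)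
    (y * d.eval (x ^ 2) : ℝ)

/-- The response function of a gate of even length: the four components are `a(x²)`, `b(x²)`,
`x y c(x²)` and `x y d(x²)`, where `x = cos (θ/2)` and `y = sin (θ/2)`. -/
noncomputable def evenForm (a b c d : ℝ[X]) (θ : ℝ) : Matrix (Fin 2) (Fin 2) ℂ :=
  let x := Real.cos (θ / 2)
  let y := Real.sin (θ / 2)
  quat (a.eval (x ^ 2) : ℝ) (b.eval (x ^ 2) : ℝ) (x * (y * c.eval (x ^ 2)) : ℝ)
    (x * (y * d.eval (x ^ 2)) : ℝ)

/-- Unitarity of `oddForm a b c d`, as a polynomial identity in `X = x²`. -/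
def OddUnitary (a b c d : ℝ[X]) : Prop :=
  X * (a ^ 2 + b ^ 2) + (1 - X) * (c ^ 2 + d ^ 2) = 1

/-- Unitarity of `evenForm a b c d`, as a polynomial identity in `X = x²`. -/
def EvenUnitary (a b c d : ℝ[X]) : Prop :=
  a ^ 2 + b ^ 2 + X * (1 - X) * (c ^ 2 + d ^ 2) = 1

theorem rotation_mul_oddForm (a b c d : ℝ[X]) (φ θ : ℝ) :
    rotation φ θ * oddForm a b c d θ =
      evenForm (X * a + (1 - X) * (C (Real.cos φ) * c + C (Real.sin φ) * d))
        (X * b + (1 - X) * (C (Real.cos φ) * d - C (Real.sin φ) * c))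
        (c - (C (Real.cos φ) * a - C (Real.sin φ) * b))
        (d - (C (Real.sin φ) * a + C (Real.cos φ) * b)) θ := by
  have h : ((Real.sin (θ / 2) : ℝ) : ℂ) ^ 2 = 1 - ((Real.cos (θ / 2) : ℝ) : ℂ) ^ 2 := by
    exact_mod_cast Real.sin_sq (θ / 2)
  simp only [rotation_eq, oddForm, evenForm, quat_mul, eval_add, eval_sub, eval_mul, eval_one,
    eval_X, eval_C, Complex.ofReal_add, Complex.ofReal_sub, Complex.ofReal_mul, Complex.ofReal_one,
    Complex.ofReal_pow]
  congr 1
  · linear_combination ((Real.cos φ : ℂ) * ((c.eval (Real.cos (θ / 2) ^ 2) : ℝ) : ℂ)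
      + (Real.sin φ : ℂ) * ((d.eval (Real.cos (θ / 2) ^ 2) : ℝ) : ℂ)) * h
  · linear_combination ((Real.cos φ : ℂ) * ((d.eval (Real.cos (θ / 2) ^ 2) : ℝ) : ℂ)
      - (Real.sin φ : ℂ) * ((c.eval (Real.cos (θ / 2) ^ 2) : ℝ) : ℂ)) * h
  · ring
  · ring

theorem rotation_mul_evenForm (a b c d : ℝ[X]) (φ θ : ℝ) :
    rotation φ θ * evenForm a b c d θ =
      oddForm (a + (1 - X) * (C (Real.cos φ) * c + C (Real.sin φ) * d))
        (b + (1 - X) * (C (Real.cos φ) * d - C (Real.sin φ) * c))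
        (X * c - (C (Real.cos φ) * a - C (Real.sin φ) * b))
        (X * d - (C (Real.sin φ) * a + C (Real.cos φ) * b)) θ := by
  have h : ((Real.sin (θ / 2) : ℝ) : ℂ) ^ 2 = 1 - ((Real.cos (θ / 2) : ℝ) : ℂ) ^ 2 := by
    exact_mod_cast Real.sin_sq (θ / 2)
  simp only [rotation_eq, oddForm, evenForm, quat_mul, eval_add, eval_sub, eval_mul, eval_one,
    eval_X, eval_C, Complex.ofReal_add, Complex.ofReal_sub, Complex.ofReal_mul, Complex.ofReal_one,
    Complex.ofReal_pow]
  congr 1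
  · linear_combination ((Real.cos (θ / 2) : ℝ) : ℂ) *
      ((Real.cos φ : ℂ) * ((c.eval (Real.cos (θ / 2) ^ 2) : ℝ) : ℂ)
      + (Real.sin φ : ℂ) * ((d.eval (Real.cos (θ / 2) ^ 2) : ℝ) : ℂ)) * h
  · linear_combination ((Real.cos (θ / 2) : ℝ) : ℂ) *
      ((Real.cos φ : ℂ) * ((d.eval (Real.cos (θ / 2) ^ 2) : ℝ) : ℂ)
      - (Real.sin φ : ℂ) * ((c.eval (Real.cos (θ / 2) ^ 2) : ℝ) : ℂ)) * h
  · ring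
  · ring

theorem C_cos_sq_add_C_sin_sq (φ : ℝ) :
    (C (Real.cos φ) ^ 2 + C (Real.sin φ) ^ 2 : ℝ[X]) = 1 := by
  rw [← C_pow, ← C_pow, ← C_add, Real.cos_sq_add_sin_sq, C_1]

/-- Every gate, whatever its phases, has a response function of one of the two forms, with a
unitary quadruple of real polynomials. -/
theorem exists_form_of_response {L : ℕ} (φ : Fin L → ℝ) :
    ∃ a b c d : ℝ[X],
      (Odd L → OddUnitary a b c d ∧ ∀ θ, response φ θ = oddForm a b c d θ) ∧
      (Even L → EvenUnitary a b c d ∧ ∀ θ, response φ θ = evenForm a b c d θ) := by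
  induction L with
  | zero =>
    refine ⟨1, 0, 0, 0, by simp, fun _ => ⟨by simp [EvenUnitary], fun θ => ?_⟩⟩
    simp [response, evenForm, quat]
  | succ L ih =>
    obtain ⟨a, b, c, d, hodd, heven⟩ := ih (Fin.init φ)
    rw [← Fin.snoc_init_self φ]
    set ψ := φ (Fin.last L)
    have hcs := C_cos_sq_add_C_sin_sq ψ
    rcases Nat.even_or_odd L with hL | hL
    · obtain ⟨hU, hR⟩ := heven hL
      refine ⟨_, _, _, _, fun _ => ⟨?_, fun θ => by
        rw [response_snoc, hR, rotation_mul_evenForm]⟩,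
        fun h => absurd h (Nat.not_even_iff_odd.mpr hL.add_one)⟩
      rw [EvenUnitary] at hU
      rw [OddUnitary]
      linear_combination hU + ((1 - X) * (a ^ 2 + b ^ 2) + X * (1 - X) ^ 2 * (c ^ 2 + d ^ 2)) * hcs
    · obtain ⟨hU, hR⟩ := hodd hL
      refine ⟨_, _, _, _, fun h => absurd h (Nat.not_odd_iff_even.mpr hL.add_one),
        fun _ => ⟨?_, fun θ => by rw [response_snoc, hR, rotation_mul_oddForm]⟩⟩
      rw [OddUnitary] at hU
      rw [EvenUnitary]
      linear_combination hU + ((1 - X) ^ 2 * (c ^ 2 + d ^ 2) + X * (1 - X) * (a ^ 2 + b ^ 2)) * hcs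

/-! ### Peeling off one rotation -/

theorem mem_degreeLT_of_coeff_eq_zero {n : ℕ} {p : ℝ[X]} (hp : p ∈ degreeLT ℝ (n + 1))
    (h : p.coeff n = 0) : p ∈ degreeLT ℝ n := by
  rw [mem_degreeLT, degree_lt_iff_coeff_zero] at *
  intro j hj
  rcases hj.eq_or_lt with rfl | hj
  · exact h
  · exact hp j hj

theorem coeff_sq_of_mem_degreeLT {n : ℕ} {p : ℝ[X]} (hp : p ∈ degreeLT ℝ (n + 1)) :
    (p ^ 2).coeff (2 * n) = p.coeff n ^ 2 := by
  have hn := natDegree_le_of_mem_degreeLT hp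
  exact coeff_pow_of_natDegree_le hn

theorem coeff_sq_succ_of_mem_degreeLT {n : ℕ} {p : ℝ[X]} (hp : p ∈ degreeLT ℝ (n + 1)) :
    (p ^ 2).coeff (2 * n + 1) = 0 := by
  have hn := natDegree_le_of_mem_degreeLT hp
  have := natDegree_pow_le_of_le 2 hn
  exact coeff_eq_zero_of_natDegree_lt (by omega)

/-- Two vectors of equal length are related by a rotation of the plane, whose angle will serve as
the phase of the last gate. -/
theorem exists_phase {a b c d : ℝ} (h : a ^ 2 + b ^ 2 = c ^ 2 + d ^ 2) :
    ∃ φ : ℝ, a = Real.cos φ * c + Real.sin φ * d ∧ b = Real.cos φ * d - Real.sin φ * c := by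
  rcases eq_or_ne (c ^ 2 + d ^ 2) 0 with h0 | h0
  · have hc : c = 0 := by nlinarith [sq_nonneg c, sq_nonneg d]
    have hd : d = 0 := by nlinarith [sq_nonneg c, sq_nonneg d]
    have ha : a = 0 := by nlinarith [sq_nonneg a, sq_nonneg b]
    have hb : b = 0 := by nlinarith [sq_nonneg a, sq_nonneg b]
    exact ⟨0, by simp [ha, hc, hd], by simp [hb, hc, hd]⟩
  · let z : ℂ := ⟨(a * c + b * d) / (c ^ 2 + d ^ 2), (a * d - b * c) / (c ^ 2 + d ^ 2)⟩
    have hz : ‖z‖ = 1 := by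
      rw [← sq_eq_sq₀ (norm_nonneg _) zero_le_one, ← Complex.normSq_eq_norm_sq,
        Complex.normSq_apply]
      simp only [z]
      field_simp
      linear_combination (c ^ 2 + d ^ 2) * h
    have hz0 : z ≠ 0 := by
      rw [← norm_ne_zero_iff, hz]; exact one_ne_zero
    refine ⟨z.arg, ?_, ?_⟩
    · rw [Complex.cos_arg hz0, Complex.sin_arg, hz]
      simp only [z]
      field_simp
      ring
    · rw [Complex.cos_arg hz0, Complex.sin_arg, hz]
      simp only [z]
      field_simp
      ring

theorem coeff_one_sub_X_mul_top {n : ℕ} {p : ℝ[X]} (hp : p ∈ degreeLT ℝ (n + 1)) :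
    ((1 - X) * p).coeff (n + 1) = -p.coeff n := by
  rw [mem_degreeLT, degree_lt_iff_coeff_zero] at hp
  rw [sub_mul, one_mul, coeff_sub, coeff_X_mul, hp _ le_rfl, zero_sub]

/-- Unitarity forces the leading coefficients of `(a, b)` and `(c, d)` to have the same length, so
that the inverse of a suitable rotation cancels all of them. -/
theorem OddUnitary.exists_rotation_mul_evenForm {m : ℕ} {a b c d : ℝ[X]}
    (hU : OddUnitary a b c d) (ha : a ∈ degreeLT ℝ (m + 1)) (hb : b ∈ degreeLT ℝ (m + 1))
    (hc : c ∈ degreeLT ℝ (m + 1)) (hd : d ∈ degreeLT ℝ (m + 1)) :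
    ∃ (φ : ℝ) (a' b' c' d' : ℝ[X]), EvenUnitary a' b' c' d' ∧
      a' ∈ degreeLT ℝ (m + 1) ∧ b' ∈ degreeLT ℝ (m + 1) ∧ c' ∈ degreeLT ℝ m ∧
      d' ∈ degreeLT ℝ m ∧ a'.eval 1 = a.eval 1 ∧
      ∀ θ, rotation φ θ * evenForm a' b' c' d' θ = oddForm a b c d θ := by
  have htop : (-a.coeff m) ^ 2 + (-b.coeff m) ^ 2 = c.coeff m ^ 2 + d.coeff m ^ 2 := by
    have h := congrArg (fun p => coeff p (2 * m + 1)) hU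
    simp only [sub_mul, one_mul, coeff_add, coeff_sub, coeff_X_mul, mul_add, coeff_one,
      coeff_sq_of_mem_degreeLT ha, coeff_sq_of_mem_degreeLT hb, coeff_sq_of_mem_degreeLT hc,
      coeff_sq_of_mem_degreeLT hd, coeff_sq_succ_of_mem_degreeLT hc,
      coeff_sq_succ_of_mem_degreeLT hd] at h
    rw [if_neg (by omega)] at h
    linear_combination h
  obtain ⟨φ, h1, h2⟩ := exists_phase htop
  have hcs := C_cos_sq_add_C_sin_sq φ
  have hcs' := Real.cos_sq_add_sin_sq φ
  have hcd : C (Real.cos φ) * c + C (Real.sin φ) * d ∈ degreeLT ℝ (m + 1) :=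
    Submodule.add_mem _ (C_mul_mem_degreeLT _ hc) (C_mul_mem_degreeLT _ hd)
  have hdc : C (Real.cos φ) * d - C (Real.sin φ) * c ∈ degreeLT ℝ (m + 1) :=
    Submodule.sub_mem _ (C_mul_mem_degreeLT _ hd) (C_mul_mem_degreeLT _ hc)
  have hab : C (Real.cos φ) * a - C (Real.sin φ) * b ∈ degreeLT ℝ (m + 1) :=
    Submodule.sub_mem _ (C_mul_mem_degreeLT _ ha) (C_mul_mem_degreeLT _ hb)
  have hba : C (Real.sin φ) * a + C (Real.cos φ) * b ∈ degreeLT ℝ (m + 1) :=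
    Submodule.add_mem _ (C_mul_mem_degreeLT _ ha) (C_mul_mem_degreeLT _ hb)
  refine ⟨φ, X * a - (1 - X) * (C (Real.cos φ) * c + C (Real.sin φ) * d),
    X * b - (1 - X) * (C (Real.cos φ) * d - C (Real.sin φ) * c),
    c + (C (Real.cos φ) * a - C (Real.sin φ) * b),
    d + (C (Real.sin φ) * a + C (Real.cos φ) * b), ?_, ?_, ?_, ?_, ?_, ?_, fun θ => ?_⟩
  · rw [OddUnitary] at hU
    rw [EvenUnitary]
    linear_combination hU + ((1 - X) ^ 2 * (c ^ 2 + d ^ 2) + X * (1 - X) * (a ^ 2 + b ^ 2)) * hcs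
  · refine mem_degreeLT_of_coeff_eq_zero
      (Submodule.sub_mem _ (X_mul_mem_degreeLT ha) (one_sub_X_mul_mem_degreeLT hcd)) ?_
    rw [coeff_sub, coeff_X_mul, coeff_one_sub_X_mul_top hcd, coeff_add, coeff_C_mul, coeff_C_mul]
    linear_combination -h1
  · refine mem_degreeLT_of_coeff_eq_zero
      (Submodule.sub_mem _ (X_mul_mem_degreeLT hb) (one_sub_X_mul_mem_degreeLT hdc)) ?_
    rw [coeff_sub, coeff_X_mul, coeff_one_sub_X_mul_top hdc, coeff_sub, coeff_C_mul, coeff_C_mul]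
    linear_combination -h2
  · refine mem_degreeLT_of_coeff_eq_zero (Submodule.add_mem _ hc hab) ?_
    rw [coeff_add, coeff_sub, coeff_C_mul, coeff_C_mul]
    linear_combination -Real.cos φ * h1 + Real.sin φ * h2 - c.coeff m * hcs'
  · refine mem_degreeLT_of_coeff_eq_zero (Submodule.add_mem _ hd hba) ?_
    rw [coeff_add, coeff_add, coeff_C_mul, coeff_C_mul]
    linear_combination -Real.sin φ * h1 - Real.cos φ * h2 - d.coeff m * hcs'
  · simp
  · rw [rotation_mul_evenForm]
    congr 1
    · linear_combination (1 - X) * a * hcs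
    · linear_combination (1 - X) * b * hcs
    · linear_combination (1 - X) * c * hcs
    · linear_combination (1 - X) * d * hcs

/-- The counterpart of `OddUnitary.exists_rotation_mul_evenForm` for even length. -/
theorem EvenUnitary.exists_rotation_mul_oddForm {m : ℕ} {a b c d : ℝ[X]}
    (hU : EvenUnitary a b c d) (ha : a ∈ degreeLT ℝ (m + 2)) (hb : b ∈ degreeLT ℝ (m + 2))
    (hc : c ∈ degreeLT ℝ (m + 1)) (hd : d ∈ degreeLT ℝ (m + 1)) :
    ∃ (φ : ℝ) (a' b' c' d' : ℝ[X]), OddUnitary a' b' c' d' ∧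
      a' ∈ degreeLT ℝ (m + 1) ∧ b' ∈ degreeLT ℝ (m + 1) ∧ c' ∈ degreeLT ℝ (m + 1) ∧
      d' ∈ degreeLT ℝ (m + 1) ∧ a'.eval 1 = a.eval 1 ∧
      ∀ θ, rotation φ θ * oddForm a' b' c' d' θ = evenForm a b c d θ := by
  have htop : (-a.coeff (m + 1)) ^ 2 + (-b.coeff (m + 1)) ^ 2 =
      c.coeff m ^ 2 + d.coeff m ^ 2 := by
    have h := congrArg (fun p => coeff p (2 * (m + 1))) hU
    have hX : X * (1 - X) * (c ^ 2 + d ^ 2) =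
      X * (c ^ 2) + X * (d ^ 2) - X * (X * c ^ 2) - X * (X * d ^ 2) := by ring
    rw [hX] at h
    simp only [coeff_add, coeff_sub, coeff_one, coeff_sq_of_mem_degreeLT ha,
      coeff_sq_of_mem_degreeLT hb] at h
    rw [if_neg (by omega), show 2 * (m + 1) = 2 * m + 1 + 1 by ring] at h
    simp only [coeff_X_mul, coeff_sq_of_mem_degreeLT hc,
      coeff_sq_of_mem_degreeLT hd, coeff_sq_succ_of_mem_degreeLT hc,
      coeff_sq_succ_of_mem_degreeLT hd] at h
    linear_combination h
  obtain ⟨φ, h1, h2⟩ := exists_phase htop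
  have hcs := C_cos_sq_add_C_sin_sq φ
  have hcs' := Real.cos_sq_add_sin_sq φ
  have hcd : C (Real.cos φ) * c + C (Real.sin φ) * d ∈ degreeLT ℝ (m + 1) :=
    Submodule.add_mem _ (C_mul_mem_degreeLT _ hc) (C_mul_mem_degreeLT _ hd)
  have hdc : C (Real.cos φ) * d - C (Real.sin φ) * c ∈ degreeLT ℝ (m + 1) :=
    Submodule.sub_mem _ (C_mul_mem_degreeLT _ hd) (C_mul_mem_degreeLT _ hc)
  have hab : C (Real.cos φ) * a - C (Real.sin φ) * b ∈ degreeLT ℝ (m + 2) :=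
    Submodule.sub_mem _ (C_mul_mem_degreeLT _ ha) (C_mul_mem_degreeLT _ hb)
  have hba : C (Real.sin φ) * a + C (Real.cos φ) * b ∈ degreeLT ℝ (m + 2) :=
    Submodule.add_mem _ (C_mul_mem_degreeLT _ ha) (C_mul_mem_degreeLT _ hb)
  refine ⟨φ, a - (1 - X) * (C (Real.cos φ) * c + C (Real.sin φ) * d),
    b - (1 - X) * (C (Real.cos φ) * d - C (Real.sin φ) * c),
    X * c + (C (Real.cos φ) * a - C (Real.sin φ) * b),
    X * d + (C (Real.sin φ) * a + C (Real.cos φ) * b), ?_, ?_, ?_, ?_, ?_, ?_, fun θ => ?_⟩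
  · rw [EvenUnitary] at hU
    rw [OddUnitary]
    linear_combination hU + ((1 - X) * (a ^ 2 + b ^ 2) + X * (1 - X) ^ 2 * (c ^ 2 + d ^ 2)) * hcs
  · refine mem_degreeLT_of_coeff_eq_zero
      (Submodule.sub_mem _ ha (one_sub_X_mul_mem_degreeLT hcd)) ?_
    rw [coeff_sub, coeff_one_sub_X_mul_top hcd, coeff_add, coeff_C_mul, coeff_C_mul]
    linear_combination -h1
  · refine mem_degreeLT_of_coeff_eq_zero
      (Submodule.sub_mem _ hb (one_sub_X_mul_mem_degreeLT hdc)) ?_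
    rw [coeff_sub, coeff_one_sub_X_mul_top hdc, coeff_sub, coeff_C_mul, coeff_C_mul]
    linear_combination -h2
  · refine mem_degreeLT_of_coeff_eq_zero (Submodule.add_mem _ (X_mul_mem_degreeLT hc) hab) ?_
    rw [coeff_add, coeff_X_mul, coeff_sub, coeff_C_mul, coeff_C_mul]
    linear_combination -Real.cos φ * h1 + Real.sin φ * h2 - c.coeff m * hcs'
  · refine mem_degreeLT_of_coeff_eq_zero (Submodule.add_mem _ (X_mul_mem_degreeLT hd) hba) ?_
    rw [coeff_add, coeff_X_mul, coeff_add, coeff_C_mul, coeff_C_mul]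
    linear_combination -Real.sin φ * h1 - Real.cos φ * h2 - d.coeff m * hcs'
  · simp
  · rw [rotation_mul_oddForm]
    congr 1
    · linear_combination (1 - X) * a * hcs
    · linear_combination (1 - X) * b * hcs
    · linear_combination (1 - X) * c * hcs
    · linear_combination (1 - X) * d * hcs

/-- One half of the simultaneous induction on the length: a phase sequence for the shorter unitary
quadruple is extended by the phase of the rotation that was cancelled. -/
theorem OddUnitary.exists_response_of_even {m : ℕ}
    (ih : ∀ a b c d : ℝ[X], EvenUnitary a b c d → a ∈ degreeLT ℝ (m + 1) →
      b ∈ degreeLT ℝ (m + 1) → c ∈ degreeLT ℝ m → d ∈ degreeLT ℝ m → a.eval 1 = 1 →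
      ∃ φ : Fin (2 * m) → ℝ, ∀ θ, response φ θ = evenForm a b c d θ)
    {a b c d : ℝ[X]} (hU : OddUnitary a b c d) (ha : a ∈ degreeLT ℝ (m + 1))
    (hb : b ∈ degreeLT ℝ (m + 1)) (hc : c ∈ degreeLT ℝ (m + 1)) (hd : d ∈ degreeLT ℝ (m + 1))
    (h1 : a.eval 1 = 1) :
    ∃ φ : Fin (2 * m + 1) → ℝ, ∀ θ, response φ θ = oddForm a b c d θ := by
  obtain ⟨ψ, a', b', c', d', hU', ha', hb', hc', hd', h1', hψ⟩ :=
    hU.exists_rotation_mul_evenForm ha hb hc hd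
  obtain ⟨φ, hφ⟩ := ih a' b' c' d' hU' ha' hb' hc' hd' (h1'.trans h1)
  exact ⟨Fin.snoc φ ψ, fun θ => by rw [response_snoc, hφ, hψ]⟩

/-- Unitarity, the degree bounds and the value `1` at `s = 1` suffice for realizability by a gate
of the matching length. -/
theorem EvenUnitary.exists_response {m : ℕ} {a b c d : ℝ[X]} (hU : EvenUnitary a b c d)
    (ha : a ∈ degreeLT ℝ (m + 1)) (hb : b ∈ degreeLT ℝ (m + 1)) (hc : c ∈ degreeLT ℝ m)
    (hd : d ∈ degreeLT ℝ m) (h1 : a.eval 1 = 1) :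
    ∃ φ : Fin (2 * m) → ℝ, ∀ θ, response φ θ = evenForm a b c d θ := by
  induction m generalizing a b c d with
  | zero =>
    have hconst : ∀ {p : ℝ[X]}, p ∈ degreeLT ℝ (0 + 1) → p = C (p.eval 1) := by
      intro p hp
      obtain ⟨r, rfl⟩ := natDegree_eq_zero.mp
        (Nat.le_zero.mp (natDegree_le_of_mem_degreeLT hp))
      simp
    have hb1 : b.eval 1 = 0 := by
      have := congrArg (eval 1) hU
      simp [h1] at this
      exact this
    refine ⟨Fin.elim0, fun θ => ?_⟩
    rw [hconst ha, hconst hb, h1, hb1, eq_zero_of_mem_degreeLT_zero hc,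
      eq_zero_of_mem_degreeLT_zero hd]
    simp [response, evenForm, quat]
  | succ m ih =>
    obtain ⟨ψ, a', b', c', d', hU', ha', hb', hc', hd', h1', hψ⟩ :=
      hU.exists_rotation_mul_oddForm ha hb hc hd
    obtain ⟨φ, hφ⟩ := hU'.exists_response_of_even (fun _ _ _ _ => ih) ha' hb' hc' hd'
      (h1'.trans h1)
    exact ⟨Fin.snoc φ ψ, fun θ => by rw [response_snoc, hφ, hψ]⟩

theorem OddUnitary.exists_response {m : ℕ} {a b c d : ℝ[X]} (hU : OddUnitary a b c d)
    (ha : a ∈ degreeLT ℝ (m + 1)) (hb : b ∈ degreeLT ℝ (m + 1)) (hc : c ∈ degreeLT ℝ (m + 1))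
    (hd : d ∈ degreeLT ℝ (m + 1)) (h1 : a.eval 1 = 1) :
    ∃ φ : Fin (2 * m + 1) → ℝ, ∀ θ, response φ θ = oddForm a b c d θ :=
  hU.exists_response_of_even (fun _ _ _ _ => EvenUnitary.exists_response) ha hb hc hd h1

/-! ### Completing a partial tuple to a unitary one -/

theorem one_mem_degreeLT_succ (n : ℕ) : (1 : ℝ[X]) ∈ degreeLT ℝ (n + 1) :=
  C_mem_degreeLT_succ 1 n

theorem sq_mem_degreeLT {n : ℕ} {p : ℝ[X]} (hp : p ∈ degreeLT ℝ (n + 1)) :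
    p ^ 2 ∈ degreeLT ℝ (2 * n + 1) := by
  have hn := natDegree_le_of_mem_degreeLT hp
  rw [mem_degreeLT]
  exact (degree_le_of_natDegree_le (natDegree_pow_le_of_le 2 hn)).trans_lt
    (by exact_mod_cast Nat.lt_succ_self _)

theorem X_mul_one_sub_X_mul_sq_mem_degreeLT {n : ℕ} {p : ℝ[X]} (hp : p ∈ degreeLT ℝ n) :
    X * (1 - X) * p ^ 2 ∈ degreeLT ℝ (2 * n + 1) := by
  rcases n with _ | n
  · simp [eq_zero_of_mem_degreeLT_zero hp]
  · rw [mul_assoc]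
    exact X_mul_mem_degreeLT (one_sub_X_mul_mem_degreeLT (sq_mem_degreeLT hp))

/-- The defect `1 - X a² - (1 - X) c²` is nonnegative on `[0, 1]`, and its Markov–Lukács
certificate consists of the missing `b` and `d`. -/
theorem exists_oddUnitary_of_ac {m : ℕ} {a c : ℝ[X]} (ha : a ∈ degreeLT ℝ (m + 1))
    (hc : c ∈ degreeLT ℝ (m + 1))
    (h : ∀ s ∈ Set.Icc (0 : ℝ) 1, s * a.eval s ^ 2 + (1 - s) * c.eval s ^ 2 ≤ 1) :
    ∃ b ∈ degreeLT ℝ (m + 1), ∃ d ∈ degreeLT ℝ (m + 1), OddUnitary a b c d := by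
  have hp : 1 - X * a ^ 2 - (1 - X) * c ^ 2 ∈ degreeLT ℝ (2 * m + 1 + 1) :=
    Submodule.sub_mem _ (Submodule.sub_mem _ (one_mem_degreeLT_succ _)
      (X_mul_mem_degreeLT (sq_mem_degreeLT ha))) (one_sub_X_mul_mem_degreeLT (sq_mem_degreeLT hc))
  obtain ⟨m', b, d, ⟨hm, hb, hd, hbd⟩ | ⟨hm, -⟩⟩ := unitIntervalForm_of_nonneg _ _ hp fun s hs => by
    have := h s hs
    simp
    linarith
  · obtain rfl : m' = m + 1 := by omega
    refine ⟨b, hb, d, hd, ?_⟩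
    rw [OddUnitary]
    linear_combination -hbd
  · omega

theorem exists_evenUnitary_of_ac {m : ℕ} {a c : ℝ[X]} (ha : a ∈ degreeLT ℝ (m + 1))
    (hc : c ∈ degreeLT ℝ m)
    (h : ∀ s ∈ Set.Icc (0 : ℝ) 1, a.eval s ^ 2 + s * (1 - s) * c.eval s ^ 2 ≤ 1) :
    ∃ b ∈ degreeLT ℝ (m + 1), ∃ d ∈ degreeLT ℝ m, EvenUnitary a b c d := by
  have hp : 1 - a ^ 2 - X * (1 - X) * c ^ 2 ∈ degreeLT ℝ (2 * m + 1) :=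
    Submodule.sub_mem _ (Submodule.sub_mem _ (one_mem_degreeLT_succ _)
      (sq_mem_degreeLT ha)) (X_mul_one_sub_X_mul_sq_mem_degreeLT hc)
  obtain ⟨m', b, d, ⟨hm, -⟩ | ⟨hm, hb, hd, hbd⟩⟩ := unitIntervalForm_of_nonneg _ _ hp fun s hs => by
    have := h s hs
    simp
    linarith
  · omega
  · obtain rfl : m' = m := by omega
    refine ⟨b, hb, d, hd, ?_⟩
    rw [EvenUnitary]
    linear_combination -hbd

/-- The defect `1 - X (a² + b²)` has the zero `s = 1`, and its quotient by `1 - X` is nonnegative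
on the whole real line; for `s ≤ 0` this needs no hypothesis. -/
theorem exists_oddUnitary_of_ab {m : ℕ} {a b : ℝ[X]} (ha : a ∈ degreeLT ℝ (m + 1))
    (hb : b ∈ degreeLT ℝ (m + 1))
    (h : ∀ s ∈ Set.Icc (0 : ℝ) 1, s * (a.eval s ^ 2 + b.eval s ^ 2) ≤ 1)
    (h' : ∀ s, 1 ≤ s → 1 ≤ s * (a.eval s ^ 2 + b.eval s ^ 2)) :
    ∃ c ∈ degreeLT ℝ (m + 1), ∃ d ∈ degreeLT ℝ (m + 1), OddUnitary a b c d := by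
  have hp : 1 - X * (a ^ 2 + b ^ 2) ∈ degreeLT ℝ (2 * m + 1 + 1) :=
    Submodule.sub_mem _ (one_mem_degreeLT_succ _) (X_mul_mem_degreeLT
      (Submodule.add_mem _ (sq_mem_degreeLT ha) (sq_mem_degreeLT hb)))
  have hroot : (1 - X * (a ^ 2 + b ^ 2)).IsRoot 1 := by
    have h1 := h 1 (by simp)
    have h2 := h' 1 le_rfl
    simp
    linarith
  obtain ⟨q, hq⟩ := dvd_iff_isRoot.mpr hroot
  replace hq : 1 - X * (a ^ 2 + b ^ 2) = (1 - X) * -q := by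
    rw [hq, C_1]; ring
  have hdeg : (1 - X : ℝ[X]).natDegree = 1 := by
    compute_degree!
  have hne : (1 - X : ℝ[X]) ≠ 0 := ne_zero_of_natDegree_gt (n := 0) (by omega)
  obtain ⟨c, hc, d, hd, hcd⟩ := exists_sq_add_sq_of_nonneg (m + 1) (-q)
    (degreeLT_mono (by omega) (mem_degreeLT_of_mul hdeg hne (hq ▸ hp)))
    (eval_nonneg_of_mul_univ hne fun s => by
      rw [← hq]
      simp only [eval_sub, eval_add, eval_mul, eval_pow, eval_one, eval_X]
      rcases le_or_gt s 0 with h0 | h0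
      · refine mul_nonneg (by linarith) ?_
        nlinarith [sq_nonneg (a.eval s), sq_nonneg (b.eval s)]
      rcases le_or_gt s 1 with h1 | h1
      · exact mul_nonneg (by linarith) (by linarith [h s ⟨h0.le, h1⟩])
      · exact mul_nonneg_of_nonpos_of_nonpos (by linarith) (by linarith [h' s h1.le]))
  refine ⟨c, hc, d, hd, ?_⟩
  rw [OddUnitary]
  linear_combination -hq - (1 - X) * hcd

/-- The defect `1 - a² - b²` has the zeros `s = 0` and `s = 1`, and its quotient by `X (1 - X)` is
nonnegative on the whole real line. -/
theorem exists_evenUnitary_of_ab {m : ℕ} {a b : ℝ[X]} (ha : a ∈ degreeLT ℝ (m + 1))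
    (hb : b ∈ degreeLT ℝ (m + 1))
    (h : ∀ s ∈ Set.Icc (0 : ℝ) 1, a.eval s ^ 2 + b.eval s ^ 2 ≤ 1)
    (h' : ∀ s, 1 ≤ s → 1 ≤ a.eval s ^ 2 + b.eval s ^ 2)
    (h'' : ∀ s, s ≤ 0 → 1 ≤ a.eval s ^ 2 + b.eval s ^ 2) :
    ∃ c ∈ degreeLT ℝ m, ∃ d ∈ degreeLT ℝ m, EvenUnitary a b c d := by
  have hp : 1 - (a ^ 2 + b ^ 2) ∈ degreeLT ℝ (2 * m + 2) :=
    degreeLT_mono (by omega) (Submodule.sub_mem _ (one_mem_degreeLT_succ (2 * m))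
      (Submodule.add_mem _ (sq_mem_degreeLT ha) (sq_mem_degreeLT hb)))
  have hdvd : X * (1 - X) ∣ 1 - (a ^ 2 + b ^ 2) := by
    have hcop : IsCoprime (X : ℝ[X]) (1 - X) := ⟨1, 1, by ring⟩
    refine hcop.mul_dvd ?_ ?_
    · rw [X_dvd_iff, coeff_zero_eq_eval_zero]
      have h1 := h 0 (by simp)
      have h2 := h'' 0 le_rfl
      simp
      linarith
    · rw [← neg_dvd, neg_sub, ← C_1, dvd_iff_isRoot]
      have h1 := h 1 (by simp)
      have h2 := h' 1 le_rfl
      simp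
      linarith
  obtain ⟨q, hq⟩ := hdvd
  have hdeg : (X * (1 - X) : ℝ[X]).natDegree = 2 := by
    rw [show (X * (1 - X) : ℝ[X]) = X - X ^ 2 by ring]
    compute_degree!
  have hne : (X * (1 - X) : ℝ[X]) ≠ 0 := ne_zero_of_natDegree_gt (n := 0) (by omega)
  obtain ⟨c, hc, d, hd, hcd⟩ := exists_sq_add_sq_of_nonneg m q
    (mem_degreeLT_of_mul hdeg hne (hq ▸ hp))
    (eval_nonneg_of_mul_univ hne fun s => by
      rw [← hq]
      simp only [eval_sub, eval_add, eval_mul, eval_pow, eval_one, eval_X]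
      rcases le_or_gt s 0 with h0 | h0
      · exact mul_nonneg_of_nonpos_of_nonpos (mul_nonpos_of_nonpos_of_nonneg h0 (by linarith))
          (by linarith [h'' s h0])
      rcases le_or_gt s 1 with h1 | h1
      · exact mul_nonneg (mul_nonneg h0.le (by linarith)) (by linarith [h s ⟨h0.le, h1⟩])
      · exact mul_nonneg_of_nonpos_of_nonpos (mul_nonpos_of_nonneg_of_nonpos h0.le (by linarith))
          (by linarith [h' s h1.le]))
  refine ⟨c, hc, d, hd, ?_⟩
  rw [EvenUnitary]
  linear_combination -hq - X * (1 - X) * hcd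

/-- The defect `1 - (1 - X) (c² + d²)` has the zero `s = 0`, and its quotient by `X` is
nonnegative on the whole real line; for `1 ≤ s` this needs no hypothesis. -/
theorem exists_oddUnitary_of_cd {m : ℕ} {c d : ℝ[X]} (hc : c ∈ degreeLT ℝ (m + 1))
    (hd : d ∈ degreeLT ℝ (m + 1))
    (h : ∀ s ∈ Set.Icc (0 : ℝ) 1, (1 - s) * (c.eval s ^ 2 + d.eval s ^ 2) ≤ 1)
    (h' : ∀ s, s ≤ 0 → 1 ≤ (1 - s) * (c.eval s ^ 2 + d.eval s ^ 2)) :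
    ∃ a ∈ degreeLT ℝ (m + 1), ∃ b ∈ degreeLT ℝ (m + 1),
      OddUnitary a b c d ∧ a.eval 1 = 1 := by
  have hp : 1 - (1 - X) * (c ^ 2 + d ^ 2) ∈ degreeLT ℝ (2 * m + 1 + 1) :=
    Submodule.sub_mem _ (one_mem_degreeLT_succ _) (one_sub_X_mul_mem_degreeLT
      (Submodule.add_mem _ (sq_mem_degreeLT hc) (sq_mem_degreeLT hd)))
  have hdvd : X ∣ 1 - (1 - X) * (c ^ 2 + d ^ 2) := by
    rw [X_dvd_iff, coeff_zero_eq_eval_zero]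
    have h1 := h 0 (by simp)
    have h2 := h' 0 le_rfl
    simp at h1 h2 ⊢
    linarith
  obtain ⟨q, hq⟩ := hdvd
  obtain ⟨a, ha, b, hb, hab, h1⟩ := exists_sq_add_sq_eval_one (m := m + 1) (q := q)
    (degreeLT_mono (by omega) (mem_degreeLT_of_mul natDegree_X X_ne_zero (hq ▸ hp)))
    (eval_nonneg_of_mul_univ X_ne_zero fun s => by
      rw [← hq]
      simp only [eval_sub, eval_add, eval_mul, eval_pow, eval_one, eval_X]
      rcases le_or_gt s 0 with h0 | h0
      · exact mul_nonneg_of_nonpos_of_nonpos h0 (by linarith [h' s h0])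
      rcases le_or_gt s 1 with h1 | h1
      · exact mul_nonneg h0.le (by linarith [h s ⟨h0.le, h1⟩])
      · refine mul_nonneg h0.le ?_
        nlinarith [sq_nonneg (c.eval s), sq_nonneg (d.eval s)])
    (by simpa using (congrArg (eval 1) hq).symm)
  refine ⟨a, ha, b, hb, ?_, h1⟩
  rw [OddUnitary]
  linear_combination -hq - X * hab

/-- The defect `1 - X (1 - X) (c² + d²)` is at least `1` outside `[0, 1]`, so no condition is
needed there. -/
theorem exists_evenUnitary_of_cd {m : ℕ} {c d : ℝ[X]} (hc : c ∈ degreeLT ℝ m)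
    (hd : d ∈ degreeLT ℝ m)
    (h : ∀ s ∈ Set.Icc (0 : ℝ) 1, s * (1 - s) * (c.eval s ^ 2 + d.eval s ^ 2) ≤ 1) :
    ∃ a ∈ degreeLT ℝ (m + 1), ∃ b ∈ degreeLT ℝ (m + 1),
      EvenUnitary a b c d ∧ a.eval 1 = 1 := by
  have hp : 1 - (X * (1 - X) * c ^ 2 + X * (1 - X) * d ^ 2) ∈ degreeLT ℝ (2 * m + 1) :=
    Submodule.sub_mem _ (one_mem_degreeLT_succ _) (Submodule.add_mem _
      (X_mul_one_sub_X_mul_sq_mem_degreeLT hc) (X_mul_one_sub_X_mul_sq_mem_degreeLT hd))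
  obtain ⟨a, ha, b, hb, hab, h1⟩ := exists_sq_add_sq_eval_one (m := m + 1)
    (degreeLT_mono (by omega) hp) (fun s => by
      simp only [eval_sub, eval_add, eval_mul, eval_pow, eval_one, eval_X]
      by_cases hs : s ∈ Set.Icc (0 : ℝ) 1
      · linarith [h s hs]
      · have : s * (1 - s) ≤ 0 := by
          rw [Set.mem_Icc, not_and_or, not_le, not_le] at hs
          rcases hs with hs | hs <;> nlinarith
        nlinarith [sq_nonneg (c.eval s), sq_nonneg (d.eval s)])
    (by simp)
  refine ⟨a, ha, b, hb, ?_, h1⟩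
  rw [EvenUnitary]
  linear_combination -hab

/-! ### Polynomials of definite parity -/

theorem coeff_comp_neg_X (p : ℝ[X]) (n : ℕ) : (p.comp (-X)).coeff n = p.coeff n * (-1) ^ n := by
  rw [← comp_C_mul_X_coeff, C_neg, C_1, neg_one_mul]

theorem IsEvenPoly.exists_comp {p : ℝ[X]} (hp : IsEvenPoly p) :
    ∃ a : ℝ[X], p = a.comp (X ^ 2) ∧ ∀ n, p.natDegree ≤ 2 * n + 1 → a ∈ degreeLT ℝ (n + 1) := by
  refine ⟨contract 2 p, ?_, fun n hn => ?_⟩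
  · rw [← expand_eq_comp_X_pow]
    ext n
    rw [coeff_expand two_pos, coeff_contract two_ne_zero]
    split_ifs with h
    · rw [Nat.div_mul_cancel h]
    · have := congrArg (coeff · n) hp
      simp only [coeff_comp_neg_X] at this
      rw [(Nat.odd_iff.mpr (by omega) : Odd n).neg_one_pow] at this
      linarith
  · rw [mem_degreeLT, degree_lt_iff_coeff_zero]
    intro j hj
    rw [coeff_contract two_ne_zero]
    exact coeff_eq_zero_of_natDegree_lt (by omega)

theorem IsOddPoly.exists_comp {p : ℝ[X]} (hp : IsOddPoly p) :
    ∃ a : ℝ[X], p = X * a.comp (X ^ 2) ∧ ∀ n, p.natDegree ≤ 2 * n → a ∈ degreeLT ℝ n := by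
  have hcoeff : ∀ n, Even n → p.coeff n = 0 := by
    intro n hn
    have := congrArg (coeff · n) hp
    simp only [coeff_comp_neg_X, coeff_neg, hn.neg_one_pow] at this
    linarith
  refine ⟨contract 2 p.divX, ?_, fun n hn => ?_⟩
  · rw [← expand_eq_comp_X_pow]
    ext (_ | n)
    · simp [hcoeff 0 (by simp)]
    · rw [coeff_X_mul, coeff_expand two_pos, coeff_contract two_ne_zero]
      split_ifs with h
      · rw [Nat.div_mul_cancel h, coeff_divX]
      · exact hcoeff _ (Nat.even_iff.mpr (by omega))
  · rw [mem_degreeLT, degree_lt_iff_coeff_zero]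
    intro j hj
    rw [coeff_contract two_ne_zero, coeff_divX]
    exact coeff_eq_zero_of_natDegree_lt (by omega)

/-- The inner polynomial is taken in `s = 1 - X²`: for `X = y = sin (θ/2)` this is `x²`, the
variable in which the other two entries are written. -/
theorem IsOddPoly.exists_comp_one_sub {p : ℝ[X]} (hp : IsOddPoly p) :
    ∃ c : ℝ[X], p = X * c.comp (1 - X ^ 2) ∧ ∀ n, p.natDegree ≤ 2 * n → c ∈ degreeLT ℝ n := by
  obtain ⟨a, ha, hdeg⟩ := hp.exists_comp
  refine ⟨a.comp (1 - X), ?_, fun n hn => ?_⟩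
  · rw [ha, comp_assoc]
    simp
  · have := hdeg n hn
    rcases eq_or_ne a 0 with rfl | h0
    · simp
    rw [mem_degreeLT] at this ⊢
    refine degree_le_natDegree.trans_lt (lt_of_le_of_lt ?_ this)
    rw [degree_eq_natDegree h0]
    have h1 : (1 - X : ℝ[X]).natDegree ≤ 1 := by compute_degree
    have := natDegree_comp_le (p := a) (q := 1 - X)
    exact_mod_cast this.trans (by nlinarith)

/-! ### Achievable tuples and unitary quadruples -/

theorem polyForm_odd {L : ℕ} (hL : Odd L) (A B C D : ℂ[X]) (θ : ℝ) :
    polyForm L A B C D θ = quat (A.eval ((Real.cos (θ / 2) : ℝ) : ℂ))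
      (B.eval ((Real.cos (θ / 2) : ℝ) : ℂ)) (C.eval ((Real.sin (θ / 2) : ℝ) : ℂ))
      (D.eval ((Real.sin (θ / 2) : ℝ) : ℂ)) := by
  simp only [polyForm, if_pos hL, quat]

theorem polyForm_even {L : ℕ} (hL : Even L) (A B C D : ℂ[X]) (θ : ℝ) :
    polyForm L A B C D θ = quat (A.eval ((Real.cos (θ / 2) : ℝ) : ℂ))
      (B.eval ((Real.cos (θ / 2) : ℝ) : ℂ))
      (((Real.cos (θ / 2) : ℝ) : ℂ) * C.eval ((Real.sin (θ / 2) : ℝ) : ℂ))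
      (((Real.cos (θ / 2) : ℝ) : ℂ) * D.eval ((Real.sin (θ / 2) : ℝ) : ℂ)) := by
  simp only [polyForm, if_neg (Nat.not_odd_iff_even.mpr hL), quat]

theorem eval_map_ofRealHom (p : ℝ[X]) (r : ℝ) :
    (p.map Complex.ofRealHom).eval (r : ℂ) = ((p.eval r : ℝ) : ℂ) := by
  rw [show (r : ℂ) = Complex.ofRealHom r from rfl, eval_map_apply]
  rfl

theorem natDegree_comp_sq_le {n : ℕ} {a w : ℝ[X]} (ha : a ∈ degreeLT ℝ (n + 1))
    (hw : w.natDegree ≤ 2) : (a.comp w).natDegree ≤ 2 * n := by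
  have hn := natDegree_le_of_mem_degreeLT ha
  refine natDegree_comp_le.trans ?_
  nlinarith

/-- For `n = 0` the polynomial vanishes, so the truncated subtraction is harmless. -/
theorem natDegree_X_mul_comp_sq_le {n : ℕ} {a w : ℝ[X]} (ha : a ∈ degreeLT ℝ n)
    (hw : w.natDegree ≤ 2) : (X * a.comp w).natDegree ≤ 2 * n - 1 := by
  rcases n with _ | n
  · simp [eq_zero_of_mem_degreeLT_zero ha]
  · have := natDegree_comp_sq_le ha hw
    have := natDegree_X_le (R := ℝ)
    refine natDegree_mul_le.trans ?_
    omega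

theorem natDegree_one_sub_X_sq_le : (1 - X ^ 2 : ℝ[X]).natDegree ≤ 2 := by compute_degree

theorem OddUnitary.achievableBy {m : ℕ} {a b c d : ℝ[X]} (hU : OddUnitary a b c d)
    (ha : a ∈ degreeLT ℝ (m + 1)) (hb : b ∈ degreeLT ℝ (m + 1)) (hc : c ∈ degreeLT ℝ (m + 1))
    (hd : d ∈ degreeLT ℝ (m + 1)) (h1 : a.eval 1 = 1) :
    AchievableBy (2 * m + 1) ((X * a.comp (X ^ 2)).map Complex.ofRealHom)
      ((X * b.comp (X ^ 2)).map Complex.ofRealHom)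
      ((X * c.comp (1 - X ^ 2)).map Complex.ofRealHom)
      ((X * d.comp (1 - X ^ 2)).map Complex.ofRealHom) := by
  have hX : (X ^ 2 : ℝ[X]).natDegree ≤ 2 := natDegree_X_pow_le 2
  have hX' := natDegree_one_sub_X_sq_le
  refine ⟨natDegree_map_le.trans (natDegree_X_mul_comp_sq_le ha hX),
    natDegree_map_le.trans (natDegree_X_mul_comp_sq_le hb hX),
    natDegree_map_le.trans (natDegree_X_mul_comp_sq_le hc hX'),
    natDegree_map_le.trans (natDegree_X_mul_comp_sq_le hd hX'), ?_⟩
  obtain ⟨φ, hφ⟩ := hU.exists_response ha hb hc hd h1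
  refine ⟨φ, fun θ => ?_⟩
  rw [hφ, polyForm_odd ⟨m, rfl⟩, oddForm]
  simp only [eval_map_ofRealHom, eval_mul, eval_X, eval_comp, eval_pow, eval_sub, eval_one,
    ← Real.cos_sq']

theorem EvenUnitary.achievableBy {m : ℕ} {a b c d : ℝ[X]} (hU : EvenUnitary a b c d)
    (ha : a ∈ degreeLT ℝ (m + 1)) (hb : b ∈ degreeLT ℝ (m + 1)) (hc : c ∈ degreeLT ℝ m)
    (hd : d ∈ degreeLT ℝ m) (h1 : a.eval 1 = 1) :
    AchievableBy (2 * m) ((a.comp (X ^ 2)).map Complex.ofRealHom)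
      ((b.comp (X ^ 2)).map Complex.ofRealHom)
      ((X * c.comp (1 - X ^ 2)).map Complex.ofRealHom)
      ((X * d.comp (1 - X ^ 2)).map Complex.ofRealHom) := by
  have hX : (X ^ 2 : ℝ[X]).natDegree ≤ 2 := natDegree_X_pow_le 2
  have hX' := natDegree_one_sub_X_sq_le
  refine ⟨natDegree_map_le.trans (natDegree_comp_sq_le ha hX),
    natDegree_map_le.trans (natDegree_comp_sq_le hb hX),
    natDegree_map_le.trans ((natDegree_X_mul_comp_sq_le hc hX').trans (Nat.sub_le _ _)),
    natDegree_map_le.trans ((natDegree_X_mul_comp_sq_le hd hX').trans (Nat.sub_le _ _)), ?_⟩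
  obtain ⟨φ, hφ⟩ := hU.exists_response ha hb hc hd h1
  refine ⟨φ, fun θ => ?_⟩
  rw [hφ, polyForm_even (even_two_mul m), evenForm]
  simp only [eval_map_ofRealHom, eval_mul, eval_X, eval_comp, eval_pow, eval_sub, eval_one,
    ← Real.cos_sq', Complex.ofReal_mul]

theorem eq_of_eval_cos_eq {p q : ℝ[X]}
    (h : ∀ θ : ℝ, p.eval (Real.cos (θ / 2)) = q.eval (Real.cos (θ / 2))) : p = q := by
  refine eq_of_infinite_eval_eq p q ((Set.Icc_infinite (show (-1 : ℝ) < 1 by norm_num)).mono ?_)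
  intro x hx
  have := h (2 * Real.arccos x)
  rwa [mul_div_cancel_left₀ _ two_ne_zero, Real.cos_arccos hx.1 hx.2] at this

/-- The restriction `cos (θ/2) ≠ 0` only excludes the two values `sin (θ/2) = ±1`. -/
theorem eq_of_eval_sin_eq {p q : ℝ[X]}
    (h : ∀ θ : ℝ, Real.cos (θ / 2) ≠ 0 →
      p.eval (Real.sin (θ / 2)) = q.eval (Real.sin (θ / 2))) : p = q := by
  refine eq_of_infinite_eval_eq p q ((Set.Ioo_infinite (show (-1 : ℝ) < 1 by norm_num)).mono ?_)
  intro y hy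
  have := h (2 * Real.arcsin y)
  rw [mul_div_cancel_left₀ _ two_ne_zero, Real.sin_arcsin hy.1.le hy.2.le] at this
  refine this ?_
  rw [Real.cos_arcsin]
  exact (Real.sqrt_pos.mpr (by nlinarith [hy.1, hy.2])).ne'

/-- The filled slots of an achievable partial tuple are entries of a unitary quadruple of real
polynomials. The slots are determined by the response function, as polynomials, because they are
known at infinitely many points. -/
theorem PartialAchievableParity.exists_oddUnitary {L : ℕ} (hL : Odd L)
    {sA sB sC sD : Option ℝ[X]} (h : PartialAchievableParity L sA sB sC sD) :
    ∃ a b c d : ℝ[X], OddUnitary a b c d ∧ (∀ p ∈ sA, p = X * a.comp (X ^ 2)) ∧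
      (∀ p ∈ sB, p = X * b.comp (X ^ 2)) ∧ (∀ p ∈ sC, p = X * c.comp (1 - X ^ 2)) ∧
      ∀ p ∈ sD, p = X * d.comp (1 - X ^ 2) := by
  obtain ⟨n, hn, A, B, C, D, hA, hB, hC, hD, -, -, -, -, φ, hφ⟩ := h
  obtain ⟨a, b, c, d, hodd, -⟩ := exists_form_of_response φ
  obtain ⟨hU, hR⟩ := hodd (hn.mpr hL)
  have key := fun θ => quat_inj ((polyForm_odd (hn.mpr hL) A B C D θ).symm.trans
    ((hφ θ).symm.trans (hR θ)))
  refine ⟨a, b, c, d, hU, fun p hp => eq_of_eval_cos_eq fun θ => ?_,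
    fun p hp => eq_of_eval_cos_eq fun θ => ?_, fun p hp => eq_of_eval_sin_eq fun θ _ => ?_,
    fun p hp => eq_of_eval_sin_eq fun θ _ => ?_⟩
  · have := (key θ).1
    rw [hA p hp, eval_map_ofRealHom] at this
    simpa using Complex.ofReal_injective this
  · have := (key θ).2.1
    rw [hB p hp, eval_map_ofRealHom] at this
    simpa using Complex.ofReal_injective this
  · have := (key θ).2.2.1
    rw [hC p hp, eval_map_ofRealHom] at this
    simpa [← Real.cos_sq'] using Complex.ofReal_injective this
  · have := (key θ).2.2.2
    rw [hD p hp, eval_map_ofRealHom] at this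
    simpa [← Real.cos_sq'] using Complex.ofReal_injective this

/-- The counterpart of `PartialAchievableParity.exists_oddUnitary` for even length. -/
theorem PartialAchievableParity.exists_evenUnitary {L : ℕ} (hL : Even L)
    {sA sB sC sD : Option ℝ[X]} (h : PartialAchievableParity L sA sB sC sD) :
    ∃ a b c d : ℝ[X], EvenUnitary a b c d ∧ (∀ p ∈ sA, p = a.comp (X ^ 2)) ∧
      (∀ p ∈ sB, p = b.comp (X ^ 2)) ∧ (∀ p ∈ sC, p = X * c.comp (1 - X ^ 2)) ∧
      ∀ p ∈ sD, p = X * d.comp (1 - X ^ 2) := by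
  obtain ⟨n, hn, A, B, C, D, hA, hB, hC, hD, -, -, -, -, φ, hφ⟩ := h
  obtain ⟨a, b, c, d, -, heven⟩ := exists_form_of_response φ
  have hn' : Even n := by
    rw [← Nat.not_odd_iff_even] at hL ⊢
    rwa [hn]
  obtain ⟨hU, hR⟩ := heven hn'
  have key := fun θ => quat_inj ((polyForm_even hn' A B C D θ).symm.trans
    ((hφ θ).symm.trans (hR θ)))
  refine ⟨a, b, c, d, hU, fun p hp => eq_of_eval_cos_eq fun θ => ?_,
    fun p hp => eq_of_eval_cos_eq fun θ => ?_, fun p hp => eq_of_eval_sin_eq fun θ hθ => ?_,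
    fun p hp => eq_of_eval_sin_eq fun θ hθ => ?_⟩
  · have := (key θ).1
    rw [hA p hp, eval_map_ofRealHom] at this
    simpa using Complex.ofReal_injective this
  · have := (key θ).2.1
    rw [hB p hp, eval_map_ofRealHom] at this
    simpa using Complex.ofReal_injective this
  · have := (key θ).2.2.1
    rw [hC p hp, eval_map_ofRealHom, ← Complex.ofReal_mul] at this
    simpa [← Real.cos_sq'] using mul_left_cancel₀ hθ (Complex.ofReal_injective this)
  · have := (key θ).2.2.2
    rw [hD p hp, eval_map_ofRealHom, ← Complex.ofReal_mul] at this
    simpa [← Real.cos_sq'] using mul_left_cancel₀ hθ (Complex.ofReal_injective this)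

theorem PartialAchievableBy.parity {L : ℕ} {sA sB sC sD : Option ℝ[X]}
    (h : PartialAchievableBy L sA sB sC sD) : PartialAchievableParity L sA sB sC sD :=
  ⟨L, Iff.rfl, h⟩

/-- A tuple of real polynomials realized by a gate realizes each of its partial tuples. -/
theorem AchievableBy.partialAchievableBy {L : ℕ} {A B C D : ℝ[X]}
    (h : AchievableBy L (A.map Complex.ofRealHom) (B.map Complex.ofRealHom)
      (C.map Complex.ofRealHom) (D.map Complex.ofRealHom)) {sA sB sC sD : Option ℝ[X]}
    (hA : ∀ p ∈ sA, p = A) (hB : ∀ p ∈ sB, p = B) (hC : ∀ p ∈ sC, p = C)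
    (hD : ∀ p ∈ sD, p = D) : PartialAchievableBy L sA sB sC sD :=
  ⟨_, _, _, _, fun p hp => by rw [hA p hp], fun p hp => by rw [hB p hp],
    fun p hp => by rw [hC p hp], fun p hp => by rw [hD p hp], h⟩

theorem exists_cos_sq_eq {s : ℝ} (hs : s ∈ Set.Icc (0 : ℝ) 1) :
    ∃ θ : ℝ, Real.cos (θ / 2) ^ 2 = s ∧ Real.sin (θ / 2) ^ 2 = 1 - s := by
  have h : Real.cos (2 * Real.arccos √s / 2) ^ 2 = s := by
    rw [mul_div_cancel_left₀ _ two_ne_zero, Real.cos_arccos, Real.sq_sqrt hs.1]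
    · linarith [Real.sqrt_nonneg s]
    · exact Real.sqrt_le_one.mpr hs.2
  exact ⟨_, h, by rw [Real.sin_sq, h]⟩

/-! ### The partial tuples -/

theorem OddUnitary.swap_ab {a b c d : ℝ[X]} (h : OddUnitary a b c d) : OddUnitary b a c d := by
  rw [OddUnitary] at *
  linear_combination h

theorem OddUnitary.swap_cd {a b c d : ℝ[X]} (h : OddUnitary a b c d) : OddUnitary a b d c := by
  rw [OddUnitary] at *
  linear_combination h

theorem EvenUnitary.swap_ab {a b c d : ℝ[X]} (h : EvenUnitary a b c d) :
    EvenUnitary b a c d := by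
  rw [EvenUnitary] at *
  linear_combination h

theorem EvenUnitary.swap_cd {a b c d : ℝ[X]} (h : EvenUnitary a b c d) :
    EvenUnitary a b d c := by
  rw [EvenUnitary] at *
  linear_combination h

theorem OddUnitary.eval {a b c d : ℝ[X]} (h : OddUnitary a b c d) (s : ℝ) :
    s * (a.eval s ^ 2 + b.eval s ^ 2) + (1 - s) * (c.eval s ^ 2 + d.eval s ^ 2) = 1 := by
  simpa using congrArg (Polynomial.eval s) h

theorem EvenUnitary.eval {a b c d : ℝ[X]} (h : EvenUnitary a b c d) (s : ℝ) :
    a.eval s ^ 2 + b.eval s ^ 2 + s * (1 - s) * (c.eval s ^ 2 + d.eval s ^ 2) = 1 := by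
  simpa using congrArg (Polynomial.eval s) h

theorem oddEntry_eval_cos (a : ℝ[X]) (θ : ℝ) :
    (X * a.comp (X ^ 2)).eval (Real.cos (θ / 2)) =
      Real.cos (θ / 2) * a.eval (Real.cos (θ / 2) ^ 2) := by
  simp

theorem evenEntry_eval_cos (a : ℝ[X]) (θ : ℝ) :
    (a.comp (X ^ 2)).eval (Real.cos (θ / 2)) = a.eval (Real.cos (θ / 2) ^ 2) := by
  simp

theorem entry_eval_sin (c : ℝ[X]) (θ : ℝ) :
    (X * c.comp (1 - X ^ 2)).eval (Real.sin (θ / 2)) =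
      Real.sin (θ / 2) * c.eval (Real.cos (θ / 2) ^ 2) := by
  simp [← Real.cos_sq']

theorem OddUnitary.ac_le {a b c d : ℝ[X]} (h : OddUnitary a b c d) (θ : ℝ) :
    (X * a.comp (X ^ 2)).eval (Real.cos (θ / 2)) ^ 2
      + (X * c.comp (1 - X ^ 2)).eval (Real.sin (θ / 2)) ^ 2 ≤ 1 := by
  have := h.eval (Real.cos (θ / 2) ^ 2)
  rw [← Real.sin_sq] at this
  rw [oddEntry_eval_cos, entry_eval_sin]
  nlinarith [sq_nonneg (Real.cos (θ / 2) * b.eval (Real.cos (θ / 2) ^ 2)),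
    sq_nonneg (Real.sin (θ / 2) * d.eval (Real.cos (θ / 2) ^ 2))]

theorem EvenUnitary.ac_le {a b c d : ℝ[X]} (h : EvenUnitary a b c d) (θ : ℝ) :
    (a.comp (X ^ 2)).eval (Real.cos (θ / 2)) ^ 2 + Real.cos (θ / 2) ^ 2
      * (X * c.comp (1 - X ^ 2)).eval (Real.sin (θ / 2)) ^ 2 ≤ 1 := by
  have := h.eval (Real.cos (θ / 2) ^ 2)
  rw [← Real.sin_sq] at this
  rw [evenEntry_eval_cos, entry_eval_sin]
  nlinarith [sq_nonneg (b.eval (Real.cos (θ / 2) ^ 2)),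
    sq_nonneg (Real.cos (θ / 2) * Real.sin (θ / 2) * d.eval (Real.cos (θ / 2) ^ 2))]

theorem ac_le_of_forall_odd {a c : ℝ[X]} (h : ∀ θ : ℝ,
    (X * a.comp (X ^ 2)).eval (Real.cos (θ / 2)) ^ 2
      + (X * c.comp (1 - X ^ 2)).eval (Real.sin (θ / 2)) ^ 2 ≤ 1) :
    ∀ s ∈ Set.Icc (0 : ℝ) 1, s * a.eval s ^ 2 + (1 - s) * c.eval s ^ 2 ≤ 1 := by
  intro s hs
  obtain ⟨θ, hcos, hsin⟩ := exists_cos_sq_eq hs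
  have := h θ
  rwa [oddEntry_eval_cos, entry_eval_sin, mul_pow, mul_pow, hcos, hsin] at this

theorem ac_le_of_forall_even {a c : ℝ[X]} (h : ∀ θ : ℝ,
    (a.comp (X ^ 2)).eval (Real.cos (θ / 2)) ^ 2 + Real.cos (θ / 2) ^ 2
      * (X * c.comp (1 - X ^ 2)).eval (Real.sin (θ / 2)) ^ 2 ≤ 1) :
    ∀ s ∈ Set.Icc (0 : ℝ) 1, a.eval s ^ 2 + s * (1 - s) * c.eval s ^ 2 ≤ 1 := by
  intro s hs
  obtain ⟨θ, hcos, hsin⟩ := exists_cos_sq_eq hs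
  have := h θ
  rwa [evenEntry_eval_cos, entry_eval_sin, mul_pow, hcos, hsin, ← mul_assoc] at this

/-- The letters in `tfae_ac_odd` and its companions name the filled slots; the slots are written
through the polynomials in `s` from which they arise. -/
theorem tfae_ac_odd {m : ℕ} {a c : ℝ[X]} (ha : a ∈ degreeLT ℝ (m + 1))
    (hc : c ∈ degreeLT ℝ (m + 1)) (h1 : a.eval 1 = 1) :
    List.TFAE [
      PartialAchievableBy (2 * m + 1) (some (X * a.comp (X ^ 2))) none
        (some (X * c.comp (1 - X ^ 2))) none,
      PartialAchievableParity (2 * m + 1) (some (X * a.comp (X ^ 2))) none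
        (some (X * c.comp (1 - X ^ 2))) none,
      PartialAchievableBy (2 * m + 1) (some (X * a.comp (X ^ 2))) none none
        (some (X * c.comp (1 - X ^ 2))),
      PartialAchievableParity (2 * m + 1) (some (X * a.comp (X ^ 2))) none none
        (some (X * c.comp (1 - X ^ 2))),
      ∀ θ : ℝ, (X * a.comp (X ^ 2)).eval (Real.cos (θ / 2)) ^ 2
        + (X * c.comp (1 - X ^ 2)).eval (Real.sin (θ / 2)) ^ 2 ≤ 1] := by
  have hL : Odd (2 * m + 1) := ⟨m, rfl⟩
  tfae_have 1 → 2 := PartialAchievableBy.parity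
  tfae_have 3 → 4 := PartialAchievableBy.parity
  tfae_have 2 → 5 := by
    intro h
    obtain ⟨a', b', c', d', hU, hA, -, hC, -⟩ := h.exists_oddUnitary hL
    rw [hA _ rfl, hC _ rfl]
    exact hU.ac_le
  tfae_have 4 → 5 := by
    intro h
    obtain ⟨a', b', c', d', hU, hA, -, -, hD⟩ := h.exists_oddUnitary hL
    rw [hA _ rfl, hD _ rfl]
    exact hU.swap_cd.ac_le
  tfae_have 5 → 1 := by
    intro h
    obtain ⟨b, hb, d, hd, hU⟩ := exists_oddUnitary_of_ac ha hc (ac_le_of_forall_odd h)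
    exact (hU.achievableBy ha hb hc hd h1).partialAchievableBy
      (by simp) (by simp) (by simp) (by simp)
  tfae_have 5 → 3 := by
    intro h
    obtain ⟨b, hb, d, hd, hU⟩ := exists_oddUnitary_of_ac ha hc (ac_le_of_forall_odd h)
    exact (hU.swap_cd.achievableBy ha hb hd hc h1).partialAchievableBy
      (by simp) (by simp) (by simp) (by simp)
  tfae_finish

theorem tfae_ac_even {m : ℕ} {a c : ℝ[X]} (ha : a ∈ degreeLT ℝ (m + 1))
    (hc : c ∈ degreeLT ℝ m) (h1 : a.eval 1 = 1) :
    List.TFAE [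
      PartialAchievableBy (2 * m) (some (a.comp (X ^ 2))) none
        (some (X * c.comp (1 - X ^ 2))) none,
      PartialAchievableParity (2 * m) (some (a.comp (X ^ 2))) none
        (some (X * c.comp (1 - X ^ 2))) none,
      PartialAchievableBy (2 * m) (some (a.comp (X ^ 2))) none none
        (some (X * c.comp (1 - X ^ 2))),
      PartialAchievableParity (2 * m) (some (a.comp (X ^ 2))) none none
        (some (X * c.comp (1 - X ^ 2))),
      ∀ θ : ℝ, (a.comp (X ^ 2)).eval (Real.cos (θ / 2)) ^ 2 + Real.cos (θ / 2) ^ 2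
        * (X * c.comp (1 - X ^ 2)).eval (Real.sin (θ / 2)) ^ 2 ≤ 1] := by
  have hL : Even (2 * m) := even_two_mul m
  tfae_have 1 → 2 := PartialAchievableBy.parity
  tfae_have 3 → 4 := PartialAchievableBy.parity
  tfae_have 2 → 5 := by
    intro h
    obtain ⟨a', b', c', d', hU, hA, -, hC, -⟩ := h.exists_evenUnitary hL
    rw [hA _ rfl, hC _ rfl]
    exact hU.ac_le
  tfae_have 4 → 5 := by
    intro h
    obtain ⟨a', b', c', d', hU, hA, -, -, hD⟩ := h.exists_evenUnitary hL
    rw [hA _ rfl, hD _ rfl]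
    exact hU.swap_cd.ac_le
  tfae_have 5 → 1 := by
    intro h
    obtain ⟨b, hb, d, hd, hU⟩ := exists_evenUnitary_of_ac ha hc (ac_le_of_forall_even h)
    exact (hU.achievableBy ha hb hc hd h1).partialAchievableBy
      (by simp) (by simp) (by simp) (by simp)
  tfae_have 5 → 3 := by
    intro h
    obtain ⟨b, hb, d, hd, hU⟩ := exists_evenUnitary_of_ac ha hc (ac_le_of_forall_even h)
    exact (hU.swap_cd.achievableBy ha hb hd hc h1).partialAchievableBy
      (by simp) (by simp) (by simp) (by simp)
  tfae_finish

/-- At `s = 1` unitarity leaves the value `±1` for the completing polynomial; its sign is free. -/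
theorem exists_oddUnitary_of_bc {m : ℕ} {b c : ℝ[X]} (hb : b ∈ degreeLT ℝ (m + 1))
    (hc : c ∈ degreeLT ℝ (m + 1)) (h1 : b.eval 1 = 0)
    (h : ∀ s ∈ Set.Icc (0 : ℝ) 1, s * b.eval s ^ 2 + (1 - s) * c.eval s ^ 2 ≤ 1) :
    ∃ a ∈ degreeLT ℝ (m + 1), ∃ d ∈ degreeLT ℝ (m + 1), OddUnitary a b c d ∧ a.eval 1 = 1 := by
  obtain ⟨a, ha, d, hd, hU⟩ := exists_oddUnitary_of_ac hb hc h
  have hsq : a.eval 1 ^ 2 = 1 := by simpa [h1] using hU.eval 1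
  have hC : (C (a.eval 1) ^ 2 : ℝ[X]) = 1 := by rw [← C_pow, hsq, C_1]
  refine ⟨C (a.eval 1) * a, C_mul_mem_degreeLT _ ha, d, hd, ?_, ?_⟩
  · rw [OddUnitary] at *
    linear_combination hU + X * a ^ 2 * hC
  · rw [eval_mul, eval_C, ← sq, hsq]

theorem exists_evenUnitary_of_bc {m : ℕ} {b c : ℝ[X]} (hb : b ∈ degreeLT ℝ (m + 1))
    (hc : c ∈ degreeLT ℝ m) (h1 : b.eval 1 = 0)
    (h : ∀ s ∈ Set.Icc (0 : ℝ) 1, b.eval s ^ 2 + s * (1 - s) * c.eval s ^ 2 ≤ 1) :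
    ∃ a ∈ degreeLT ℝ (m + 1), ∃ d ∈ degreeLT ℝ m, EvenUnitary a b c d ∧ a.eval 1 = 1 := by
  obtain ⟨a, ha, d, hd, hU⟩ := exists_evenUnitary_of_ac hb hc h
  have hsq : a.eval 1 ^ 2 = 1 := by simpa [h1] using hU.eval 1
  have hC : (C (a.eval 1) ^ 2 : ℝ[X]) = 1 := by rw [← C_pow, hsq, C_1]
  refine ⟨C (a.eval 1) * a, C_mul_mem_degreeLT _ ha, d, hd, ?_, ?_⟩
  · rw [EvenUnitary] at *
    linear_combination hU + a ^ 2 * hC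
  · rw [eval_mul, eval_C, ← sq, hsq]

theorem tfae_bc_odd {m : ℕ} {b c : ℝ[X]} (hb : b ∈ degreeLT ℝ (m + 1))
    (hc : c ∈ degreeLT ℝ (m + 1)) (h1 : b.eval 1 = 0) :
    List.TFAE [
      PartialAchievableBy (2 * m + 1) none (some (X * b.comp (X ^ 2)))
        (some (X * c.comp (1 - X ^ 2))) none,
      PartialAchievableParity (2 * m + 1) none (some (X * b.comp (X ^ 2)))
        (some (X * c.comp (1 - X ^ 2))) none,
      PartialAchievableBy (2 * m + 1) none (some (X * b.comp (X ^ 2))) none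
        (some (X * c.comp (1 - X ^ 2))),
      PartialAchievableParity (2 * m + 1) none (some (X * b.comp (X ^ 2))) none
        (some (X * c.comp (1 - X ^ 2))),
      ∀ θ : ℝ, (X * b.comp (X ^ 2)).eval (Real.cos (θ / 2)) ^ 2
        + (X * c.comp (1 - X ^ 2)).eval (Real.sin (θ / 2)) ^ 2 ≤ 1] := by
  have hL : Odd (2 * m + 1) := ⟨m, rfl⟩
  tfae_have 1 → 2 := PartialAchievableBy.parity
  tfae_have 3 → 4 := PartialAchievableBy.parity
  tfae_have 2 → 5 := by
    intro h
    obtain ⟨a', b', c', d', hU, -, hB, hC, -⟩ := h.exists_oddUnitary hL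
    rw [hB _ rfl, hC _ rfl]
    exact hU.swap_ab.ac_le
  tfae_have 4 → 5 := by
    intro h
    obtain ⟨a', b', c', d', hU, -, hB, -, hD⟩ := h.exists_oddUnitary hL
    rw [hB _ rfl, hD _ rfl]
    exact hU.swap_ab.swap_cd.ac_le
  tfae_have 5 → 1 := by
    intro h
    obtain ⟨a, ha, d, hd, hU, ha1⟩ := exists_oddUnitary_of_bc hb hc h1 (ac_le_of_forall_odd h)
    exact (hU.achievableBy ha hb hc hd ha1).partialAchievableBy
      (by simp) (by simp) (by simp) (by simp)
  tfae_have 5 → 3 := by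
    intro h
    obtain ⟨a, ha, d, hd, hU, ha1⟩ := exists_oddUnitary_of_bc hb hc h1 (ac_le_of_forall_odd h)
    exact (hU.swap_cd.achievableBy ha hb hd hc ha1).partialAchievableBy
      (by simp) (by simp) (by simp) (by simp)
  tfae_finish

theorem tfae_bc_even {m : ℕ} {b c : ℝ[X]} (hb : b ∈ degreeLT ℝ (m + 1))
    (hc : c ∈ degreeLT ℝ m) (h1 : b.eval 1 = 0) :
    List.TFAE [
      PartialAchievableBy (2 * m) none (some (b.comp (X ^ 2)))
        (some (X * c.comp (1 - X ^ 2))) none,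
      PartialAchievableParity (2 * m) none (some (b.comp (X ^ 2)))
        (some (X * c.comp (1 - X ^ 2))) none,
      PartialAchievableBy (2 * m) none (some (b.comp (X ^ 2))) none
        (some (X * c.comp (1 - X ^ 2))),
      PartialAchievableParity (2 * m) none (some (b.comp (X ^ 2))) none
        (some (X * c.comp (1 - X ^ 2))),
      ∀ θ : ℝ, (b.comp (X ^ 2)).eval (Real.cos (θ / 2)) ^ 2 + Real.cos (θ / 2) ^ 2
        * (X * c.comp (1 - X ^ 2)).eval (Real.sin (θ / 2)) ^ 2 ≤ 1] := by
  have hL : Even (2 * m) := even_two_mul m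
  tfae_have 1 → 2 := PartialAchievableBy.parity
  tfae_have 3 → 4 := PartialAchievableBy.parity
  tfae_have 2 → 5 := by
    intro h
    obtain ⟨a', b', c', d', hU, -, hB, hC, -⟩ := h.exists_evenUnitary hL
    rw [hB _ rfl, hC _ rfl]
    exact hU.swap_ab.ac_le
  tfae_have 4 → 5 := by
    intro h
    obtain ⟨a', b', c', d', hU, -, hB, -, hD⟩ := h.exists_evenUnitary hL
    rw [hB _ rfl, hD _ rfl]
    exact hU.swap_ab.swap_cd.ac_le
  tfae_have 5 → 1 := by
    intro h
    obtain ⟨a, ha, d, hd, hU, ha1⟩ := exists_evenUnitary_of_bc hb hc h1 (ac_le_of_forall_even h)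
    exact (hU.achievableBy ha hb hc hd ha1).partialAchievableBy
      (by simp) (by simp) (by simp) (by simp)
  tfae_have 5 → 3 := by
    intro h
    obtain ⟨a, ha, d, hd, hU, ha1⟩ := exists_evenUnitary_of_bc hb hc h1 (ac_le_of_forall_even h)
    exact (hU.swap_cd.achievableBy ha hb hd hc ha1).partialAchievableBy
      (by simp) (by simp) (by simp) (by simp)
  tfae_finish

theorem tfae_ab_odd {m : ℕ} {a b : ℝ[X]} (ha : a ∈ degreeLT ℝ (m + 1))
    (hb : b ∈ degreeLT ℝ (m + 1)) (h1 : a.eval 1 = 1) :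
    List.TFAE [
      PartialAchievableBy (2 * m + 1) (some (X * a.comp (X ^ 2))) (some (X * b.comp (X ^ 2)))
        none none,
      PartialAchievableParity (2 * m + 1) (some (X * a.comp (X ^ 2)))
        (some (X * b.comp (X ^ 2))) none none,
      (∀ θ : ℝ, (X * a.comp (X ^ 2)).eval (Real.cos (θ / 2)) ^ 2
        + (X * b.comp (X ^ 2)).eval (Real.cos (θ / 2)) ^ 2 ≤ 1) ∧
      ∀ x : ℝ, 1 ≤ x →
        1 ≤ (X * a.comp (X ^ 2)).eval x ^ 2 + (X * b.comp (X ^ 2)).eval x ^ 2] := by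
  tfae_have 1 → 2 := PartialAchievableBy.parity
  tfae_have 2 → 3 := by
    intro h
    obtain ⟨a', b', c', d', hU, hA, hB, -, -⟩ := h.exists_oddUnitary ⟨m, rfl⟩
    rw [hA _ rfl, hB _ rfl]
    refine ⟨fun θ => ?_, fun x hx => ?_⟩
    · have := hU.eval (Real.cos (θ / 2) ^ 2)
      rw [← Real.sin_sq] at this
      rw [oddEntry_eval_cos, oddEntry_eval_cos]
      nlinarith [sq_nonneg (Real.sin (θ / 2) * c'.eval (Real.cos (θ / 2) ^ 2)),
        sq_nonneg (Real.sin (θ / 2) * d'.eval (Real.cos (θ / 2) ^ 2))]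
    · have := hU.eval (x ^ 2)
      have hx2 : 0 ≤ x ^ 2 - 1 := by nlinarith
      have := mul_nonneg hx2 (add_nonneg (sq_nonneg (c'.eval (x ^ 2)))
        (sq_nonneg (d'.eval (x ^ 2))))
      simp only [eval_mul, eval_X, eval_comp, eval_pow]
      linarith
  tfae_have 3 → 1 := by
    rintro ⟨h, h'⟩
    obtain ⟨c, hc, d, hd, hU⟩ := exists_oddUnitary_of_ab ha hb
      (fun s hs => by
        obtain ⟨θ, hcos, -⟩ := exists_cos_sq_eq hs
        have := h θ
        rw [oddEntry_eval_cos, oddEntry_eval_cos, mul_pow, mul_pow, hcos] at this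
        linarith)
      (fun s hs => by
        have := h' √s (Real.one_le_sqrt.mpr hs)
        simp only [eval_mul, eval_X, eval_comp, eval_pow, mul_pow,
          Real.sq_sqrt (zero_le_one.trans hs)] at this
        linarith)
    exact (hU.achievableBy ha hb hc hd h1).partialAchievableBy
      (by simp) (by simp) (by simp) (by simp)
  tfae_finish

theorem aeval_I_mul_comp_X_sq (a : ℝ[X]) (x : ℝ) :
    aeval (Complex.I * (x : ℂ)) (a.comp (X ^ 2)) = ((a.eval (-x ^ 2) : ℝ) : ℂ) := by
  rw [aeval_comp, map_pow, aeval_X, mul_pow, Complex.I_sq, neg_one_mul, ← Complex.ofReal_pow,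
    ← Complex.ofReal_neg]
  exact aeval_algebraMap_apply ℂ (-x ^ 2) a

theorem tfae_ab_even {m : ℕ} {a b : ℝ[X]} (ha : a ∈ degreeLT ℝ (m + 1))
    (hb : b ∈ degreeLT ℝ (m + 1)) (h1 : a.eval 1 = 1) :
    List.TFAE [
      PartialAchievableBy (2 * m) (some (a.comp (X ^ 2))) (some (b.comp (X ^ 2))) none none,
      PartialAchievableParity (2 * m) (some (a.comp (X ^ 2))) (some (b.comp (X ^ 2))) none none,
      (∀ θ : ℝ, (a.comp (X ^ 2)).eval (Real.cos (θ / 2)) ^ 2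
        + (b.comp (X ^ 2)).eval (Real.cos (θ / 2)) ^ 2 ≤ 1) ∧
      (∀ x : ℝ, 1 ≤ x → 1 ≤ (a.comp (X ^ 2)).eval x ^ 2 + (b.comp (X ^ 2)).eval x ^ 2) ∧
      ∀ x : ℝ, 0 ≤ x → (1 : ℂ) ≤ aeval (Complex.I * (x : ℂ)) (a.comp (X ^ 2)) ^ 2
        + aeval (Complex.I * (x : ℂ)) (b.comp (X ^ 2)) ^ 2] := by
  tfae_have 1 → 2 := PartialAchievableBy.parity
  tfae_have 2 → 3 := by
    intro h
    obtain ⟨a', b', c', d', hU, hA, hB, -, -⟩ := h.exists_evenUnitary (even_two_mul m)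
    rw [hA _ rfl, hB _ rfl]
    refine ⟨fun θ => ?_, fun x hx => ?_, fun x _ => ?_⟩
    · have := hU.eval (Real.cos (θ / 2) ^ 2)
      rw [← Real.sin_sq] at this
      rw [evenEntry_eval_cos, evenEntry_eval_cos]
      nlinarith [sq_nonneg (Real.cos (θ / 2) * Real.sin (θ / 2) *
          c'.eval (Real.cos (θ / 2) ^ 2)),
        sq_nonneg (Real.cos (θ / 2) * Real.sin (θ / 2) * d'.eval (Real.cos (θ / 2) ^ 2))]
    · have := hU.eval (x ^ 2)
      have hx2 : 0 ≤ x ^ 2 * (x ^ 2 - 1) := mul_nonneg (sq_nonneg x) (by nlinarith)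
      have := mul_nonneg hx2 (add_nonneg (sq_nonneg (c'.eval (x ^ 2)))
        (sq_nonneg (d'.eval (x ^ 2))))
      simp only [eval_X, eval_comp, eval_pow]
      linarith
    · have := hU.eval (-x ^ 2)
      have hx2 : 0 ≤ x ^ 2 * (1 + x ^ 2) := by positivity
      have := mul_nonneg hx2 (add_nonneg (sq_nonneg (c'.eval (-x ^ 2)))
        (sq_nonneg (d'.eval (-x ^ 2))))
      rw [aeval_I_mul_comp_X_sq, aeval_I_mul_comp_X_sq]
      have hreal : 1 ≤ a'.eval (-x ^ 2) ^ 2 + b'.eval (-x ^ 2) ^ 2 := by linarith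
      exact_mod_cast hreal
  tfae_have 3 → 1 := by
    rintro ⟨h, h', h''⟩
    obtain ⟨c, hc, d, hd, hU⟩ := exists_evenUnitary_of_ab ha hb
      (fun s hs => by
        obtain ⟨θ, hcos, -⟩ := exists_cos_sq_eq hs
        have := h θ
        rwa [evenEntry_eval_cos, evenEntry_eval_cos, hcos] at this)
      (fun s hs => by
        have := h' √s (Real.one_le_sqrt.mpr hs)
        simpa only [eval_X, eval_comp, eval_pow, Real.sq_sqrt (zero_le_one.trans hs)] using this)
      (fun s hs => by
        have := h'' √(-s) (Real.sqrt_nonneg _)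
        rw [aeval_I_mul_comp_X_sq, aeval_I_mul_comp_X_sq, Real.sq_sqrt (by linarith),
          neg_neg] at this
        exact_mod_cast this)
    exact (hU.achievableBy ha hb hc hd h1).partialAchievableBy
      (by simp) (by simp) (by simp) (by simp)
  tfae_finish

theorem tfae_cd_odd {m : ℕ} {c d : ℝ[X]} (hc : c ∈ degreeLT ℝ (m + 1))
    (hd : d ∈ degreeLT ℝ (m + 1)) :
    List.TFAE [
      PartialAchievableBy (2 * m + 1) none none (some (X * c.comp (1 - X ^ 2)))
        (some (X * d.comp (1 - X ^ 2))),
      PartialAchievableParity (2 * m + 1) none none (some (X * c.comp (1 - X ^ 2)))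
        (some (X * d.comp (1 - X ^ 2))),
      (∀ θ : ℝ, (X * c.comp (1 - X ^ 2)).eval (Real.sin (θ / 2)) ^ 2
        + (X * d.comp (1 - X ^ 2)).eval (Real.sin (θ / 2)) ^ 2 ≤ 1) ∧
      ∀ y : ℝ, 1 ≤ y →
        1 ≤ (X * c.comp (1 - X ^ 2)).eval y ^ 2 + (X * d.comp (1 - X ^ 2)).eval y ^ 2] := by
  tfae_have 1 → 2 := PartialAchievableBy.parity
  tfae_have 2 → 3 := by
    intro h
    obtain ⟨a', b', c', d', hU, -, -, hC, hD⟩ := h.exists_oddUnitary ⟨m, rfl⟩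
    rw [hC _ rfl, hD _ rfl]
    refine ⟨fun θ => ?_, fun y hy => ?_⟩
    · have := hU.eval (Real.cos (θ / 2) ^ 2)
      rw [← Real.sin_sq] at this
      rw [entry_eval_sin, entry_eval_sin]
      nlinarith [sq_nonneg (Real.cos (θ / 2) * a'.eval (Real.cos (θ / 2) ^ 2)),
        sq_nonneg (Real.cos (θ / 2) * b'.eval (Real.cos (θ / 2) ^ 2))]
    · have := hU.eval (1 - y ^ 2)
      have hy2 : 0 ≤ y ^ 2 - 1 := by nlinarith
      have := mul_nonneg hy2 (add_nonneg (sq_nonneg (a'.eval (1 - y ^ 2)))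
        (sq_nonneg (b'.eval (1 - y ^ 2))))
      simp only [eval_mul, eval_X, eval_comp, eval_pow, eval_sub, eval_one]
      linarith
  tfae_have 3 → 1 := by
    rintro ⟨h, h'⟩
    obtain ⟨a, ha, b, hb, hU, h1⟩ := exists_oddUnitary_of_cd hc hd
      (fun s hs => by
        obtain ⟨θ, hcos, hsin⟩ := exists_cos_sq_eq hs
        have := h θ
        rw [entry_eval_sin, entry_eval_sin, mul_pow, mul_pow, hcos, hsin] at this
        linarith)
      (fun s hs => by
        have := h' √(1 - s) (Real.one_le_sqrt.mpr (by linarith))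
        simp only [eval_mul, eval_X, eval_comp, eval_pow, eval_sub, eval_one, mul_pow,
          Real.sq_sqrt (show 0 ≤ 1 - s by linarith), sub_sub_cancel] at this
        linarith)
    exact (hU.achievableBy ha hb hc hd h1).partialAchievableBy
      (by simp) (by simp) (by simp) (by simp)
  tfae_finish

theorem tfae_cd_even {m : ℕ} {c d : ℝ[X]} (hc : c ∈ degreeLT ℝ m) (hd : d ∈ degreeLT ℝ m) :
    List.TFAE [
      PartialAchievableBy (2 * m) none none (some (X * c.comp (1 - X ^ 2)))
        (some (X * d.comp (1 - X ^ 2))),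
      PartialAchievableParity (2 * m) none none (some (X * c.comp (1 - X ^ 2)))
        (some (X * d.comp (1 - X ^ 2))),
      ∀ θ : ℝ, Real.cos (θ / 2) ^ 2 * (X * c.comp (1 - X ^ 2)).eval (Real.sin (θ / 2)) ^ 2
        + Real.cos (θ / 2) ^ 2 * (X * d.comp (1 - X ^ 2)).eval (Real.sin (θ / 2)) ^ 2 ≤ 1] := by
  tfae_have 1 → 2 := PartialAchievableBy.parity
  tfae_have 2 → 3 := by
    intro h θ
    obtain ⟨a', b', c', d', hU, -, -, hC, hD⟩ := h.exists_evenUnitary (even_two_mul m)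
    rw [hC _ rfl, hD _ rfl]
    have := hU.eval (Real.cos (θ / 2) ^ 2)
    rw [← Real.sin_sq] at this
    rw [entry_eval_sin, entry_eval_sin]
    nlinarith [sq_nonneg (a'.eval (Real.cos (θ / 2) ^ 2)),
      sq_nonneg (b'.eval (Real.cos (θ / 2) ^ 2))]
  tfae_have 3 → 1 := by
    intro h
    obtain ⟨a, ha, b, hb, hU, h1⟩ := exists_evenUnitary_of_cd hc hd
      (fun s hs => by
        obtain ⟨θ, hcos, hsin⟩ := exists_cos_sq_eq hs
        have := h θ
        rw [entry_eval_sin, entry_eval_sin, mul_pow, mul_pow, hcos, hsin] at this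
        linarith)
    exact (hU.achievableBy ha hb hc hd h1).partialAchievableBy
      (by simp) (by simp) (by simp) (by simp)
  tfae_finish

end CompositeGate

theorem theorem2 (L : ℕ) (A B C D : ℝ[X])
    (hA : A.natDegree ≤ L) (hB : B.natDegree ≤ L)
    (hC : C.natDegree ≤ L) (hD : D.natDegree ≤ L)
    (hodd : Odd L → CompositeGate.IsOddPoly A ∧ CompositeGate.IsOddPoly B ∧
      CompositeGate.IsOddPoly C ∧ CompositeGate.IsOddPoly D)
    (heven : Even L → CompositeGate.IsEvenPoly A ∧ CompositeGate.IsEvenPoly B ∧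
      CompositeGate.IsOddPoly C ∧ CompositeGate.IsOddPoly D) :
    -- the tuples `(A, ·, C, ·)` and `(A, ·, ·, C)`
    (A.eval 1 = 1 →
      List.TFAE [
        CompositeGate.PartialAchievableBy L (some A) none (some C) none,
        CompositeGate.PartialAchievableParity L (some A) none (some C) none,
        CompositeGate.PartialAchievableBy L (some A) none none (some C),
        CompositeGate.PartialAchievableParity L (some A) none none (some C),
        ∀ θ : ℝ,
          (Odd L → (A.eval (Real.cos (θ / 2))) ^ 2 + (C.eval (Real.sin (θ / 2))) ^ 2 ≤ 1) ∧
          (Even L → (A.eval (Real.cos (θ / 2))) ^ 2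
            + (Real.cos (θ / 2)) ^ 2 * (C.eval (Real.sin (θ / 2))) ^ 2 ≤ 1)]) ∧
    -- the tuples `(·, B, C, ·)` and `(·, B, ·, C)`
    (B.eval 1 = 0 →
      List.TFAE [
        CompositeGate.PartialAchievableBy L none (some B) (some C) none,
        CompositeGate.PartialAchievableParity L none (some B) (some C) none,
        CompositeGate.PartialAchievableBy L none (some B) none (some C),
        CompositeGate.PartialAchievableParity L none (some B) none (some C),
        ∀ θ : ℝ,
          (Odd L → (B.eval (Real.cos (θ / 2))) ^ 2 + (C.eval (Real.sin (θ / 2))) ^ 2 ≤ 1) ∧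
          (Even L → (B.eval (Real.cos (θ / 2))) ^ 2
            + (Real.cos (θ / 2)) ^ 2 * (C.eval (Real.sin (θ / 2))) ^ 2 ≤ 1)]) ∧
    -- the tuple `(A, B, ·, ·)`
    (A.eval 1 = 1 →
      List.TFAE [
        CompositeGate.PartialAchievableBy L (some A) (some B) none none,
        CompositeGate.PartialAchievableParity L (some A) (some B) none none,
        (∀ θ : ℝ, (A.eval (Real.cos (θ / 2))) ^ 2 + (B.eval (Real.cos (θ / 2))) ^ 2 ≤ 1) ∧
        (∀ x : ℝ, 1 ≤ x → 1 ≤ (A.eval x) ^ 2 + (B.eval x) ^ 2) ∧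
        (Even L → ∀ x : ℝ, 0 ≤ x →
          (1 : ℂ) ≤ (Polynomial.aeval (Complex.I * (x : ℂ)) A) ^ 2
            + (Polynomial.aeval (Complex.I * (x : ℂ)) B) ^ 2)]) ∧
    -- the tuple `(·, ·, C, D)`
    List.TFAE [
      CompositeGate.PartialAchievableBy L none none (some C) (some D),
      CompositeGate.PartialAchievableParity L none none (some C) (some D),
      (∀ θ : ℝ,
        (Odd L → (C.eval (Real.sin (θ / 2))) ^ 2 + (D.eval (Real.sin (θ / 2))) ^ 2 ≤ 1) ∧
        (Even L → (Real.cos (θ / 2)) ^ 2 * (C.eval (Real.sin (θ / 2))) ^ 2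
          + (Real.cos (θ / 2)) ^ 2 * (D.eval (Real.sin (θ / 2))) ^ 2 ≤ 1)) ∧
      (Odd L → ∀ y : ℝ, 1 ≤ y → 1 ≤ (C.eval y) ^ 2 + (D.eval y) ^ 2)] := by
  rcases Nat.even_or_odd' L with ⟨m, rfl | rfl⟩
  · have hL : Even (2 * m) := even_two_mul m
    have hL' : ¬Odd (2 * m) := Nat.not_odd_iff_even.mpr hL
    obtain ⟨hA', hB', hC', hD'⟩ := heven hL
    obtain ⟨a, rfl, ha⟩ := hA'.exists_comp
    obtain ⟨b, rfl, hb⟩ := hB'.exists_comp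
    obtain ⟨c, rfl, hc⟩ := hC'.exists_comp_one_sub
    obtain ⟨d, rfl, hd⟩ := hD'.exists_comp_one_sub
    replace ha := ha m (by omega)
    replace hb := hb m (by omega)
    replace hc := hc m hC
    replace hd := hd m hD
    simp only [hL, hL', forall_const, false_imp_iff, true_and, and_true]
    exact ⟨fun h1 => CompositeGate.tfae_ac_even ha hc (by simpa using h1),
      fun h1 => CompositeGate.tfae_bc_even hb hc (by simpa using h1),
      fun h1 => CompositeGate.tfae_ab_even ha hb (by simpa using h1),
      CompositeGate.tfae_cd_even hc hd⟩
  · have hL : Odd (2 * m + 1) := odd_two_mul_add_one m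
    have hL' : ¬Even (2 * m + 1) := Nat.not_even_iff_odd.mpr hL
    obtain ⟨hA', hB', hC', hD'⟩ := hodd hL
    obtain ⟨a, rfl, ha⟩ := hA'.exists_comp
    obtain ⟨b, rfl, hb⟩ := hB'.exists_comp
    obtain ⟨c, rfl, hc⟩ := hC'.exists_comp_one_sub
    obtain ⟨d, rfl, hd⟩ := hD'.exists_comp_one_sub
    replace ha := ha (m + 1) (by omega)
    replace hb := hb (m + 1) (by omega)
    replace hc := hc (m + 1) (by omega)
    replace hd := hd (m + 1) (by omega)
    simp only [hL, hL', forall_const, false_imp_iff, and_true]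
    exact ⟨fun h1 => CompositeGate.tfae_ac_odd ha hc (by simpa using h1),
      fun h1 => CompositeGate.tfae_bc_odd hb hc (by simpa using h1),
      fun h1 => CompositeGate.tfae_ab_odd ha hb (by simpa using h1),
      CompositeGate.tfae_cd_odd hc hd⟩
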